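/- **Theorem B.1.** Identify the flat torus $\mathbb T^2=(\mathbb R/\mathbb Z)^2$ with the unit cell $[0,1)^2$. Let $0<\alpha\le 1$, and let $\eta:\mathbb T^2\to\mathbb R$ be $\alpha$-Hölder continuous with Hölder constant at most $C_\alpha$ and with $\sup_{\mathbb T^2}|\eta|\le L$. Let $$\mathcal O_\eta=\{(x,y,z)\in\mathbb R^3:\ (x,y)\in[0,1)^2,\ 0<z<\eta(x,y)\}.$$ For $0\le s<1$ let $H^s(\mathbb R^3)$ be the space of (scalar- or vector-valued) $U\in L^2(\mathbb R^3)$ with $$\|U\|_{H^s(\mathbb R^3)}^2=\int_{\mathbb R^3}|U|^2\,dx+\iint_{\mathbb R^3\times\mathbb R^3}\frac{|U(x)-U(y)|^2}{|x-y|^{3+2s}}\,dx\,dy<\infty$$ (the double integral is omitted when $s=0$, so that $H^0=L^2$), and let $H^s(\mathcal O_\eta)$ be the space of restrictions $u=U|_{\mathcal O_\eta}$ of functions $U\in H^s(\mathbb R^3)$, with the norm $\|u\|_{H^s(\mathcal O_\eta)}=\inf\{\|U\|_{H^s(\mathbb R^3)}: U|_{\mathcal O_\eta}=u\}$. Then for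 every $0\le s<\alpha/2$ and every $u\in H^s(\mathcal O_\eta)$ the extension by zero, $\tilde u=u$ in $\mathcal O_\eta$ and $\tilde u=0$ in $\mathbb R^3\setminus\mathcal O_\eta$, belongs to $H^{s\alpha}(\mathbb R^3)$, and $$\|\tilde u\|_{H^{s\alpha}(\mathbb R^3)}\le C\,\|u\|_{H^s(\mathcal O_\eta)},$$ where the constant $C$ depends only on $s$, $L$, $\alpha$ and the Hölder constant $C_\alpha$ (not on $\eta$ or $u$ otherwise). -/

import Mathlib

open MeasureTheory Set
open scoped ENNReal NNReal

namespace ZeroExtension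

/-- Euclidean three-space. -/
abbrev R3 : Type := EuclideanSpace ℝ (Fin 3)

/-- The two-dimensional flat torus `(ℝ/ℤ)²`. -/
abbrev Torus2 : Type := UnitAddCircle × UnitAddCircle

/-- The subgraph `{(x, y, z) : (x, y) ∈ 𝕋², 0 < z < η (x, y)}` as a subset of `ℝ³`; each point of
the torus is represented by its unique representative in the unit cell `[0, 1)²`. -/
def subgraph (η : Torus2 → ℝ) : Set R3 :=
  {p | p 0 ∈ Ico (0 : ℝ) 1 ∧ p 1 ∈ Ico (0 : ℝ) 1 ∧
    0 < p 2 ∧ p 2 < η ((p 0 : UnitAddCircle), (p 1 : UnitAddCircle))}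

section Sobolev

variable {F : Type*} [NormedAddCommGroup F]

/-- The square of the Gagliardo (Sobolev-Slobodeckij) seminorm of order `s ∈ [0, 1)` on `ℝ³`,
`∬ |u(x) - u(y)|² / |x - y|^(3 + 2s) dx dy`; it is absent for `s = 0`, since `H⁰ = L²`. -/
noncomputable def gagliardoSq (s : ℝ) (u : R3 → F) : ℝ≥0∞ :=
  open Classical in
  if s = 0 then 0
  else ∫⁻ x : R3, ∫⁻ y : R3, ‖u x - u y‖ₑ ^ 2 / edist x y ^ (3 + 2 * s)

/-- The norm of `H^s(ℝ³)`, `0 ≤ s < 1`, with value `∞` outside the space. -/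
noncomputable def sobolevENorm (s : ℝ) (u : R3 → F) : ℝ≥0∞ :=
  ((∫⁻ x : R3, ‖u x‖ₑ ^ 2) + gagliardoSq s u) ^ (1 / 2 : ℝ)

/-- `u ∈ H^s(ℝ³)`, `0 ≤ s < 1`. -/
def MemSobolev (s : ℝ) (u : R3 → F) : Prop :=
  AEStronglyMeasurable u volume ∧ sobolevENorm s u < ∞

/-- `u ∈ H^s(O)`: on `O`, `u` is the restriction of an element of `H^s(ℝ³)`. Only the values
of `u` on `O` matter. -/
def MemSobolevOn (s : ℝ) (O : Set R3) (u : R3 → F) : Prop :=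
  ∃ U : R3 → F, MemSobolev s U ∧ U =ᵐ[volume.restrict O] u

/-- The (quotient) norm of `H^s(O)`: the infimum of `‖U‖_{H^s(ℝ³)}` over all `U ∈ H^s(ℝ³)`
that restrict to `u` on `O`; it is `∞` outside the space. -/
noncomputable def sobolevENormOn (s : ℝ) (O : Set R3) (u : R3 → F) : ℝ≥0∞ :=
  ⨅ (U : R3 → F) (_ : MemSobolev s U) (_ : U =ᵐ[volume.restrict O] u), sobolevENorm s U

end Sobolev

end ZeroExtension

namespace ZeroExtension

/-! Let `U` extend `u` to the whole space, put `O = subgraph η` and `t = s * α`. Cutting `U` off at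
the boundary of `O` adds to its Gagliardo seminorm of order `t` only the interaction `2 ∫_O |U(x)|²
∫_{Oᶜ} |x - y|^(-3-2t) dy dx`.

A point `x` of `O` whose distance to the `j`-th face, measured along a coordinate axis, is `d_j` can
leave `O` within unit distance only by moving at least `(d_j / (K + 1))^(1/α)` for some `j`, by
Hölder continuity of `η`. The kernel tail beyond radius `R` is of size `R^(-2t)`, so the inner
integral is at most `C (1 + ∑ d_j^(-2s))`: the exponent `1/α` cancels the factor `α` in `t`
(`exists_lintegral_compl_subgraph_le`).

It remains to bound `∫ d_j^(-2s) |U|²` by the squared `H^s` norm. As `d_j` is measured along an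
axis, this is a fractional Hardy inequality on lines, valid because `s < α/2 ≤ 1/2`
(`exists_hardy_line`, `exists_hardy_graph`), with no regularity of the face needed beyond
measurability. Integrating over parallel lines gives a directional seminorm, which the full one
controls (`exists_lintegral_direction_le`). Taking the infimum over `U` finishes the proof. -/

theorem enorm_rpow_neg_le_of_one_le {E : Type*} [NormedAddCommGroup E] {x : E} {a : ℝ} (ha : 0 ≤ a) (hx : 1 ≤ ‖x‖ₑ) :
    ‖x‖ₑ ^ (-a) ≤ ENNReal.ofReal (2 ^ a) * ENNReal.ofReal ((1 + ‖x‖) ^ (-a)) := by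
  have hx' : 1 ≤ ‖x‖ := by
    rw [← ofReal_norm] at hx
    exact ENNReal.one_le_ofReal.1 hx
  rw [← ofReal_norm, ENNReal.ofReal_rpow_of_pos (by positivity), ← ENNReal.ofReal_mul (by positivity)]
  apply ENNReal.ofReal_le_ofReal
  calc ‖x‖ ^ (-a) ≤ ((1 + ‖x‖) / 2) ^ (-a) :=
        Real.rpow_le_rpow_of_nonpos (by positivity) (by linarith) (by linarith)
    _ = 2 ^ a * (1 + ‖x‖) ^ (-a) := by
        rw [Real.div_rpow (by positivity) (by norm_num), Real.rpow_neg (by norm_num : (0:ℝ) ≤ 2)]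
        field_simp

/-! ### Tails of power kernels. -/

section Kernel

variable {E : Type*} [NormedAddCommGroup E] [NormedSpace ℝ E] [FiniteDimensional ℝ E]
  [MeasurableSpace E] [BorelSpace E] (μ : Measure E) [μ.IsAddHaarMeasure]

/-- Change of variables under a homothety, for the Lebesgue integral of nonnegative functions. -/
theorem lintegral_comp_smul (f : E → ℝ≥0∞) {r : ℝ} (hr : r ≠ 0) :
    ∫⁻ x, f (r • x) ∂μ = ENNReal.ofReal |(r ^ Module.finrank ℝ E)⁻¹| * ∫⁻ x, f x ∂μ := by
  have h := (Homeomorph.smulOfNeZero r hr : E ≃ₜ E).isClosedEmbedding.measurableEmbedding.lintegral_map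
    (μ := μ) f
  have h' : (⇑(Homeomorph.smulOfNeZero r hr : E ≃ₜ E)) = (r • · : E → E) := rfl
  rw [h', Measure.map_addHaar_smul μ hr, lintegral_smul_measure, smul_eq_mul] at h
  exact h.symm

theorem exists_lintegral_one_le_enorm_le {b : ℝ} (hb : 0 < b) :
    ∃ C : ℝ≥0, ∫⁻ x in {x : E | 1 ≤ ‖x‖ₑ}, ‖x‖ₑ ^ (-(Module.finrank ℝ E + b)) ∂μ ≤ C := by
  have hfin : (∫⁻ x : E, ENNReal.ofReal ((1 + ‖x‖) ^ (-(Module.finrank ℝ E + b))) ∂μ) < ∞ :=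
    finite_integral_one_add_norm (by linarith)
  have hle : ∫⁻ x in {x : E | 1 ≤ ‖x‖ₑ}, ‖x‖ₑ ^ (-(Module.finrank ℝ E + b)) ∂μ ≤
      ENNReal.ofReal (2 ^ (Module.finrank ℝ E + b)) *
        ∫⁻ x : E, ENNReal.ofReal ((1 + ‖x‖) ^ (-(Module.finrank ℝ E + b))) ∂μ := by
    rw [← lintegral_const_mul' _ _ ENNReal.ofReal_ne_top]
    refine (setLIntegral_mono' (measurableSet_le measurable_const measurable_enorm)
      fun x hx => enorm_rpow_neg_le_of_one_le (by positivity) hx).trans (setLIntegral_le_lintegral _ _)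
  have hne := (hle.trans_lt (ENNReal.mul_lt_top ENNReal.ofReal_lt_top hfin)).ne
  exact ⟨_, (ENNReal.coe_toNNReal hne).ge⟩

/-- The tail of the kernel `‖x‖ ^ (-(n + b))` in dimension `n`. -/
theorem exists_lintegral_le_enorm_le {b : ℝ} (hb : 0 < b) :
    ∃ C : ℝ≥0, ∀ R : ℝ≥0∞,
      ∫⁻ x in {x : E | R ≤ ‖x‖ₑ}, ‖x‖ₑ ^ (-(Module.finrank ℝ E + b)) ∂μ ≤ C * R ^ (-b) := by
  obtain ⟨C, hC⟩ := exists_lintegral_one_le_enorm_le μ hb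
  -- The added 1 makes the constant nonzero, so that at `R = 0` the right-hand side is `∞` rather
  -- than `0 * ∞ = 0`.
  refine ⟨C + 1, fun R => ?_⟩
  rcases eq_or_ne R 0 with rfl | hR0
  · rw [ENNReal.zero_rpow_of_neg (by linarith), ENNReal.mul_top (by simp)]
    exact le_top
  rcases eq_or_ne R ∞ with rfl | hRt
  · simp
  have hms : MeasurableSet {x : E | 1 ≤ ‖x‖ₑ} := measurableSet_le measurable_const measurable_enorm
  have hmR : MeasurableSet {x : E | R ≤ ‖x‖ₑ} := measurableSet_le measurable_const measurable_enorm
  set n := Module.finrank ℝ E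
  obtain ⟨r, hr, rfl⟩ : ∃ r : ℝ, 0 < r ∧ R = ENNReal.ofReal r :=
    ⟨R.toReal, ENNReal.toReal_pos hR0 hRt, (ENNReal.ofReal_toReal hRt).symm⟩
  have hrinv : ENNReal.ofReal |((r⁻¹) ^ n)⁻¹| = ENNReal.ofReal r ^ (n : ℝ) := by
    rw [ENNReal.ofReal_rpow_of_pos hr, Real.rpow_natCast, inv_pow, inv_inv,
      abs_of_pos (by positivity)]
  -- Homogeneity of degree `-(n + b)` reduces to radius 1; the Jacobian `r ^ n` then leaves `r ^
  -- (-b)`.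
  have key : ∀ x : E, indicator {x : E | ENNReal.ofReal r ≤ ‖x‖ₑ} (fun x => ‖x‖ₑ ^ (-(n + b))) x =
      ENNReal.ofReal r ^ (-(n + b)) *
        indicator {x : E | 1 ≤ ‖x‖ₑ} (fun x => ‖x‖ₑ ^ (-(n + b))) (r⁻¹ • x) := by
    intro x
    have hn : ‖r⁻¹ • x‖ₑ = (ENNReal.ofReal r)⁻¹ * ‖x‖ₑ := by
      rw [enorm_smul, Real.enorm_of_nonneg (by positivity), ENNReal.ofReal_inv_of_pos hr]
    have hiff : 1 ≤ ‖r⁻¹ • x‖ₑ ↔ ENNReal.ofReal r ≤ ‖x‖ₑ := by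
      rw [hn, mul_comm, ← div_eq_mul_inv, ENNReal.le_div_iff_mul_le (.inl hR0) (.inl hRt), one_mul]
    by_cases hx : ENNReal.ofReal r ≤ ‖x‖ₑ
    · rw [indicator_of_mem (show x ∈ {x : E | ENNReal.ofReal r ≤ ‖x‖ₑ} from hx),
        indicator_of_mem (show r⁻¹ • x ∈ {x : E | 1 ≤ ‖x‖ₑ} from hiff.2 hx), hn,
        ENNReal.mul_rpow_of_ne_top (ENNReal.inv_ne_top.2 hR0) enorm_ne_top, ← mul_assoc,
        ENNReal.inv_rpow, ENNReal.mul_inv_cancel, one_mul]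
      · simp [hr]
      · simp [ENNReal.rpow_eq_top_iff, hr]
    · rw [indicator_of_notMem (show x ∉ {x : E | ENNReal.ofReal r ≤ ‖x‖ₑ} from hx),
        indicator_of_notMem (show r⁻¹ • x ∉ {x : E | 1 ≤ ‖x‖ₑ} from fun h => hx (hiff.1 h)), mul_zero]
  rw [← lintegral_indicator hmR, lintegral_congr key, lintegral_const_mul, lintegral_comp_smul μ _
    (inv_ne_zero hr.ne'), hrinv, lintegral_indicator hms, ← mul_assoc,
    ← ENNReal.rpow_add _ _ hR0 hRt, mul_comm]
  · have : -((n : ℝ) + b) + n = -b := by ring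
    rw [this]
    gcongr
    exact hC.trans (by simp)
  · exact ((measurable_enorm.pow_const _).indicator hms).comp (measurable_const_smul _)

end Kernel

/-- The gap between the two sides is `ε⁻¹ (a - ε b)²`. Small `ε` keeps the coefficient of `b²` close
to 1, as the absorption in the Hardy inequality requires. -/
theorem add_sq_le_young (a b : ℝ≥0∞) {ε : ℝ≥0} (hε : ε ≠ 0) :
    (a + b) ^ 2 ≤ ((1 + ε⁻¹ : ℝ≥0) : ℝ≥0∞) * a ^ 2 + ((1 + ε : ℝ≥0) : ℝ≥0∞) * b ^ 2 := by
  rcases eq_or_ne a ∞ with rfl | ha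
  · simp [ENNReal.mul_top]
  rcases eq_or_ne b ∞ with rfl | hb
  · simp [ENNReal.mul_top]
  lift a to ℝ≥0 using ha
  lift b to ℝ≥0 using hb
  norm_cast
  rw [← NNReal.coe_le_coe]
  push_cast
  have hε' : (0 : ℝ) < ε := by positivity
  have h : (1 + (ε : ℝ)⁻¹) * (a : ℝ) ^ 2 + (1 + ε) * (b : ℝ) ^ 2 - (a + b) ^ 2 =
      (ε : ℝ)⁻¹ * (a - ε * b) ^ 2 := by
    field_simp
    ring
  have : 0 ≤ (ε : ℝ)⁻¹ * ((a : ℝ) - ε * b) ^ 2 := by positivity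
  linarith

/-! ### Gagliardo seminorms through the `L²` modulus of continuity. -/

section Translation

variable {F : Type*} [NormedAddCommGroup F]

theorem enorm_add_sq_le (a b : F) : ‖a + b‖ₑ ^ 2 ≤ 2 * ‖a‖ₑ ^ 2 + 2 * ‖b‖ₑ ^ 2 := by
  have h := add_sq_le_young ‖a‖ₑ ‖b‖ₑ (one_ne_zero (α := ℝ≥0))
  have h2 : ((1 + 1 : ℝ≥0) : ℝ≥0∞) = 2 := by norm_num
  rw [inv_one, h2] at h
  exact (pow_le_pow_left₀ (zero_le) (enorm_add_le a b) 2).trans h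

/-- The squared `L²` modulus of continuity `∫ |U(p + h) - U(p)|² dp`. -/
noncomputable def translationSq (U : R3 → F) (h : R3) : ℝ≥0∞ :=
  ∫⁻ p : R3, ‖U (p + h) - U p‖ₑ ^ 2

variable {U : R3 → F}

theorem measurable_translation_integrand (hU : StronglyMeasurable U) :
    Measurable fun q : R3 × R3 => ‖U (q.2 + q.1) - U q.2‖ₑ ^ 2 := by
  have h : Measurable fun q : R3 × R3 => q.2 + q.1 := by fun_prop
  have h1 := hU.comp_measurable h
  have h2 : StronglyMeasurable fun q : R3 × R3 => U q.2 := hU.comp_measurable measurable_snd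
  exact (h1.sub h2).enorm.pow_const 2

theorem measurable_translation_integrand_left (hU : StronglyMeasurable U) (h : R3) :
    Measurable fun p : R3 => ‖U (p + h) - U p‖ₑ ^ 2 := by
  have h1 := hU.comp_measurable (measurable_add_const h)
  exact (h1.sub hU).enorm.pow_const 2

theorem measurable_translationSq (hU : StronglyMeasurable U) : Measurable (translationSq U) :=
  (measurable_translation_integrand hU).lintegral_prod_right'

/-- Pass through the intermediate point `p + a` and use translation invariance of the integral. -/
theorem translationSq_add_le (hU : StronglyMeasurable U) (a b : R3) :
    translationSq U (a + b) ≤ 2 * translationSq U a + 2 * translationSq U b := by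
  have hm : ∀ h : R3, Measurable fun p : R3 => ‖U (p + h) - U p‖ₑ ^ 2 :=
    measurable_translation_integrand_left hU
  have hb : ∫⁻ p : R3, ‖U (p + a + b) - U (p + a)‖ₑ ^ 2 = translationSq U b :=
    lintegral_add_right_eq_self (fun p : R3 => ‖U (p + b) - U p‖ₑ ^ 2) a
  have hmb : Measurable fun p : R3 => ‖U (p + a + b) - U (p + a)‖ₑ ^ 2 :=
    (hm b).comp (measurable_add_const a)
  rw [← hb, translationSq, translationSq, ← lintegral_const_mul _ (hm a),
    ← lintegral_const_mul _ hmb,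
    ← lintegral_add_left ((hm a).const_mul _)]
  refine lintegral_mono fun p => ?_
  have := enorm_add_sq_le (U (p + a) - U p) (U (p + a + b) - U (p + a))
  rw [sub_add_sub_comm, add_comm (U (p + a)), add_sub_add_right_eq_sub] at this
  simpa only [add_assoc] using this

theorem translationSq_le (hU : StronglyMeasurable U) (h : R3) :
    translationSq U h ≤ 4 * ∫⁻ p : R3, ‖U p‖ₑ ^ 2 := by
  have hm : Measurable fun p : R3 => ‖U p‖ₑ ^ 2 := hU.enorm.pow_const _
  have hm' : Measurable fun p : R3 => ‖U (p + h)‖ₑ ^ 2 := hm.comp (measurable_add_const h)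
  have h1 : ∫⁻ p : R3, ‖U (p + h)‖ₑ ^ 2 = ∫⁻ p : R3, ‖U p‖ₑ ^ 2 :=
    lintegral_add_right_eq_self (fun p : R3 => ‖U p‖ₑ ^ 2) h
  calc translationSq U h ≤ ∫⁻ p : R3, (2 * ‖U (p + h)‖ₑ ^ 2 + 2 * ‖U p‖ₑ ^ 2) :=
        lintegral_mono fun p => by
          simpa [sub_eq_add_neg] using enorm_add_sq_le (U (p + h)) (-U p)
    _ = 4 * ∫⁻ p : R3, ‖U p‖ₑ ^ 2 := by
        rw [lintegral_add_right _ (hm.const_mul _), lintegral_const_mul _ hm,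
          lintegral_const_mul _ hm', h1]
        ring

theorem measurable_gagliardo_integrand (hU : StronglyMeasurable U) (s : ℝ) :
    Measurable fun q : R3 × R3 => ‖U q.1 - U q.2‖ₑ ^ 2 / edist q.1 q.2 ^ (3 + 2 * s) := by
  have h1 : StronglyMeasurable fun q : R3 × R3 => U q.1 := hU.comp_measurable measurable_fst
  have h2 : StronglyMeasurable fun q : R3 × R3 => U q.2 := hU.comp_measurable measurable_snd
  have h3 : Measurable fun q : R3 × R3 => edist q.1 q.2 ^ (3 + 2 * s) :=
    (measurable_fst.edist measurable_snd).pow_const _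
  exact ((h1.sub h2).enorm.pow_const 2).div h3

/-- Substitute `y = x + h` and apply Tonelli. Order 0 is excluded because the seminorm is then 0 by
convention. -/
theorem gagliardoSq_eq_lintegral_translationSq (hU : StronglyMeasurable U) {s : ℝ} (hs : s ≠ 0) :
    gagliardoSq s U = ∫⁻ h : R3, translationSq U h * ‖h‖ₑ ^ (-(3 + 2 * s)) := by
  have h1 : ∀ x : R3, ∫⁻ y : R3, ‖U x - U y‖ₑ ^ 2 / edist x y ^ (3 + 2 * s) =
      ∫⁻ h : R3, ‖U (x + h) - U x‖ₑ ^ 2 * ‖h‖ₑ ^ (-(3 + 2 * s)) := fun x => by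
    rw [← lintegral_add_left_eq_self
      (fun y : R3 => ‖U x - U y‖ₑ ^ 2 / edist x y ^ (3 + 2 * s)) x]
    refine lintegral_congr fun h => ?_
    have h2 : edist x (x + h) = ‖h‖ₑ := by
      rw [edist_comm, edist_eq_enorm_sub, add_sub_cancel_left]
    have h3 : ‖U x - U (x + h)‖ₑ = ‖U (x + h) - U x‖ₑ := by
      rw [← edist_eq_enorm_sub, edist_comm, edist_eq_enorm_sub]
    rw [h2, h3, div_eq_mul_inv, ← ENNReal.rpow_neg]
  rw [gagliardoSq, if_neg hs, lintegral_congr h1, lintegral_lintegral_swap]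
  · refine lintegral_congr fun h => ?_
    rw [translationSq, lintegral_mul_const]
    exact measurable_translation_integrand_left hU h
  · have hsw : Measurable fun q : R3 × R3 => ‖U (q.1 + q.2) - U q.1‖ₑ ^ 2 := by
      have h2 := hU.comp_measurable (show Measurable fun q : R3 × R3 => q.1 by fun_prop)
      have h := hU.comp_measurable (show Measurable fun q : R3 × R3 => q.1 + q.2 by fun_prop)
      exact (h.sub h2).enorm.pow_const 2
    have hk : Measurable fun q : R3 × R3 => ‖q.2‖ₑ ^ (-(3 + 2 * s)) :=
      measurable_snd.enorm.pow_const _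
    have hmul : Measurable fun q : R3 × R3 =>
        ‖U (q.1 + q.2) - U q.1‖ₑ ^ 2 * ‖q.2‖ₑ ^ (-(3 + 2 * s)) := hsw.mul hk
    exact hmul.aemeasurable

/-- The Sobolev seminorms are monotone in the order, up to the `L²` norm. -/
theorem exists_gagliardoSq_le_of_le {t s : ℝ} (ht : 0 < t) (hts : t ≤ s) :
    ∃ C : ℝ≥0, ∀ {F : Type*} [NormedAddCommGroup F] {U : R3 → F}, StronglyMeasurable U →
      gagliardoSq t U ≤ gagliardoSq s U + C * ∫⁻ p : R3, ‖U p‖ₑ ^ 2 := by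
  obtain ⟨C, hC⟩ := exists_lintegral_le_enorm_le (volume : Measure R3) (b := 2 * t) (by linarith)
  refine ⟨4 * C, fun {F} _ {U} hU => ?_⟩
  have hC1 := hC 1
  rw [ENNReal.one_rpow, mul_one, finrank_euclideanSpace_fin, Nat.cast_ofNat] at hC1
  have hms : MeasurableSet {h : R3 | 1 ≤ ‖h‖ₑ} := measurableSet_le measurable_const measurable_enorm
  -- Split at `‖h‖ = 1`: inside, the kernel of order `t` lies below that of order `s`; outside, the
  -- modulus is bounded by the `L²` norm and the kernel is integrable.
  rw [gagliardoSq_eq_lintegral_translationSq hU ht.ne',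
    gagliardoSq_eq_lintegral_translationSq hU (ht.trans_le hts).ne',
    ← lintegral_add_compl _ hms.compl, compl_compl]
  gcongr ?_ + ?_
  · refine (setLIntegral_mono' hms.compl fun h hh => ?_).trans (setLIntegral_le_lintegral _ _)
    have hh' : ‖h‖ₑ < 1 := not_le.1 hh
    exact mul_le_mul' le_rfl (ENNReal.rpow_le_rpow_of_exponent_ge hh'.le (by linarith))
  · calc ∫⁻ h : R3 in {h | 1 ≤ ‖h‖ₑ}, translationSq U h * ‖h‖ₑ ^ (-(3 + 2 * t))
        ≤ ∫⁻ h : R3 in {h | 1 ≤ ‖h‖ₑ}, (4 * ∫⁻ p : R3, ‖U p‖ₑ ^ 2) * ‖h‖ₑ ^ (-(3 + 2 * t)) :=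
          lintegral_mono fun h => by gcongr; exact translationSq_le hU h
      _ = (4 * ∫⁻ p : R3, ‖U p‖ₑ ^ 2) * ∫⁻ h : R3 in {h | 1 ≤ ‖h‖ₑ}, ‖h‖ₑ ^ (-(3 + 2 * t)) :=
          lintegral_const_mul _ (measurable_enorm.pow_const (-(3 + 2 * t)))
      _ ≤ (4 * ∫⁻ p : R3, ‖U p‖ₑ ^ 2) * C := by gcongr
      _ = _ := by push_cast; ring

/-- For `h` in the ball with diameter from `0` to `e`, both `h` and `e - h` have norm at most `‖e‖`.
Integrate near-subadditivity for `e = h + (e - h)` over this ball; the reflection `h ↦ e - h` makes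
the two terms equal. The value at one vector is thus controlled by an integral over a
full-dimensional set. -/
theorem translationSq_mul_volume_ball_le (hU : StronglyMeasurable U) {e : R3} :
    translationSq U e * volume (Metric.ball ((2 : ℝ)⁻¹ • e) (‖e‖ / 2)) ≤
      4 * ∫⁻ h : R3 in {h | ‖h‖ₑ ≤ ‖e‖ₑ}, translationSq U h := by
  have hω := measurable_translationSq hU
  have hms : MeasurableSet {h : R3 | ‖h‖ₑ ≤ ‖e‖ₑ} :=
    measurableSet_le measurable_enorm measurable_const
  have hmem : ∀ h ∈ Metric.ball ((2 : ℝ)⁻¹ • e) (‖e‖ / 2), ‖h‖ₑ ≤ ‖e‖ₑ ∧ ‖e - h‖ₑ ≤ ‖e‖ₑ := by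
    intro h hh
    rw [Metric.mem_ball, dist_eq_norm] at hh
    have h2 : ‖(2 : ℝ)⁻¹ • e‖ = ‖e‖ / 2 := by rw [norm_smul]; norm_num; ring
    have h3 : e - h = (2 : ℝ)⁻¹ • e - (h - (2 : ℝ)⁻¹ • e) := by module
    rw [enorm_le_iff_norm_le, enorm_le_iff_norm_le]
    constructor
    · have := norm_add_le (h - (2 : ℝ)⁻¹ • e) ((2 : ℝ)⁻¹ • e)
      rw [sub_add_cancel] at this
      linarith
    · rw [h3]
      have := norm_sub_le ((2 : ℝ)⁻¹ • e) (h - (2 : ℝ)⁻¹ • e)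
      linarith
  have hrefl : ∫⁻ h : R3, indicator {h : R3 | ‖h‖ₑ ≤ ‖e‖ₑ} (translationSq U) (e - h) =
      ∫⁻ h : R3 in {h | ‖h‖ₑ ≤ ‖e‖ₑ}, translationSq U h := by
    rw [lintegral_sub_left_eq_self (fun h => indicator {h : R3 | ‖h‖ₑ ≤ ‖e‖ₑ} (translationSq U) h) e,
      lintegral_indicator hms]
  rw [← setLIntegral_const, show (4 : ℝ≥0∞) = 2 + 2 by norm_num, add_mul]
  calc ∫⁻ _ : R3 in Metric.ball ((2 : ℝ)⁻¹ • e) (‖e‖ / 2), translationSq U e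
      ≤ ∫⁻ h : R3 in Metric.ball ((2 : ℝ)⁻¹ • e) (‖e‖ / 2),
        (2 * indicator {h : R3 | ‖h‖ₑ ≤ ‖e‖ₑ} (translationSq U) h +
          2 * indicator {h : R3 | ‖h‖ₑ ≤ ‖e‖ₑ} (translationSq U) (e - h)) := by
        refine setLIntegral_mono' Metric.isOpen_ball.measurableSet fun h hh => ?_
        rw [indicator_of_mem (show h ∈ {h : R3 | ‖h‖ₑ ≤ ‖e‖ₑ} from (hmem h hh).1),
          indicator_of_mem (show e - h ∈ {h : R3 | ‖h‖ₑ ≤ ‖e‖ₑ} from (hmem h hh).2)]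
        simpa using translationSq_add_le hU h (e - h)
    _ ≤ ∫⁻ h : R3, (2 * indicator {h : R3 | ‖h‖ₑ ≤ ‖e‖ₑ} (translationSq U) h +
          2 * indicator {h : R3 | ‖h‖ₑ ≤ ‖e‖ₑ} (translationSq U) (e - h)) :=
        setLIntegral_le_lintegral _ _
    _ = _ := by
        have hmi := hω.indicator hms
        have hmi' : Measurable fun h =>
            indicator {h : R3 | ‖h‖ₑ ≤ ‖e‖ₑ} (translationSq U) (e - h) :=
          hmi.comp (measurable_const_sub e)
        rw [lintegral_add_left (hmi.const_mul _), lintegral_const_mul _ hmi,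
          lintegral_const_mul _ hmi', hrefl, lintegral_indicator hms]

/-- The Gagliardo seminorm along lines in a fixed direction is controlled by the full one. -/
theorem exists_lintegral_direction_le {s : ℝ} (hs : 0 < s) :
    ∃ C : ℝ≥0, ∀ {F : Type*} [NormedAddCommGroup F] {U : R3 → F}, StronglyMeasurable U →
      ∀ e : R3, ‖e‖ = 1 →
        ∫⁻ r : ℝ, translationSq U (r • e) * ‖r‖ₑ ^ (-(1 + 2 * s)) ≤ C * gagliardoSq s U := by
  obtain ⟨C, hC⟩ := exists_lintegral_le_enorm_le (volume : Measure ℝ) (b := 3 + 2 * s) (by linarith)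
  obtain ⟨c, hc⟩ : ∃ c : ℝ≥0∞, c = volume (Metric.ball (0 : R3) 1) := ⟨_, rfl⟩
  have hc0 : c ≠ 0 := hc ▸ (Metric.measure_ball_pos _ _ one_pos).ne'
  have hct : c ≠ ∞ := hc ▸ measure_ball_lt_top.ne
  -- The averaging lemma contributes 4, and the ball of radius `|r| / 2` has volume `|r|³ c / 8`.
  -- After Tonelli, the remaining `|r|^(-(4 + 2s))` is integrated over `|r| ≥ ‖h‖`, which gives `C
  -- ‖h‖^(-(3 + 2s))`.
  refine ⟨32 * c⁻¹.toNNReal * C, fun {F} _ {U} hU e he => ?_⟩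
  have hω := measurable_translationSq hU
  have hpt : ∀ r : ℝ, r ≠ 0 → translationSq U (r • e) * ‖r‖ₑ ^ (-(1 + 2 * s)) ≤
      (32 * c⁻¹) * ∫⁻ h : R3, translationSq U h *
        indicator {r : ℝ | ‖h‖ₑ ≤ ‖r‖ₑ} (fun r => ‖r‖ₑ ^ (-(1 + (3 + 2 * s)))) r := by
    intro r hr
    have hr0 : ‖r‖ₑ ≠ 0 := by simpa using hr
    have h1 := translationSq_mul_volume_ball_le hU (e := r • e)
    have hnr : ‖r • e‖ = ‖r‖ := by rw [norm_smul, he, mul_one]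
    have hner : ‖r • e‖ₑ = ‖r‖ₑ := by rw [enorm_smul, ← ofReal_norm e, he]; simp
    have hvol : volume (Metric.ball ((2 : ℝ)⁻¹ • r • e) (‖r • e‖ / 2)) =
        ‖r‖ₑ ^ (3 : ℝ) * 8⁻¹ * c := by
      rw [Measure.addHaar_ball volume _ (by positivity), ← hc, finrank_euclideanSpace_fin, hnr, div_pow,
        ENNReal.ofReal_div_of_pos (by norm_num), ENNReal.ofReal_pow (norm_nonneg r), ofReal_norm,
        div_eq_mul_inv, ← ENNReal.rpow_natCast]
      norm_num
    rw [hvol, hner] at h1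
    have h3 : ‖r‖ₑ ^ (3 : ℝ) * ‖r‖ₑ ^ (-3 : ℝ) = 1 := by
      rw [← ENNReal.rpow_add _ _ hr0 enorm_ne_top]
      norm_num
    have h4 : ‖r‖ₑ ^ (-(1 + 2 * s)) * ‖r‖ₑ ^ (-3 : ℝ) = ‖r‖ₑ ^ (-(1 + (3 + 2 * s))) := by
      rw [← ENNReal.rpow_add _ _ hr0 enorm_ne_top]
      ring_nf
    have h5 : (8 : ℝ≥0∞)⁻¹ * 8 = 1 := ENNReal.inv_mul_cancel (by norm_num) (by norm_num)
    have hms : MeasurableSet {h : R3 | ‖h‖ₑ ≤ ‖r‖ₑ} :=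
      measurableSet_le measurable_enorm measurable_const
    have h6 : ∫⁻ h : R3, translationSq U h *
        indicator {r : ℝ | ‖h‖ₑ ≤ ‖r‖ₑ} (fun r => ‖r‖ₑ ^ (-(1 + (3 + 2 * s)))) r =
        (∫⁻ h : R3 in {h | ‖h‖ₑ ≤ ‖r‖ₑ}, translationSq U h) * ‖r‖ₑ ^ (-(1 + (3 + 2 * s))) := by
      rw [← lintegral_mul_const _ hω, ← lintegral_indicator hms]
      refine lintegral_congr fun h => ?_
      by_cases hh : ‖h‖ₑ ≤ ‖r‖ₑ <;> simp [indicator, hh]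
    rw [h6]
    calc translationSq U (r • e) * ‖r‖ₑ ^ (-(1 + 2 * s))
        = translationSq U (r • e) * ‖r‖ₑ ^ (-(1 + 2 * s)) *
            (‖r‖ₑ ^ (3 : ℝ) * ‖r‖ₑ ^ (-3 : ℝ)) * (8⁻¹ * 8) * (c * c⁻¹) := by
          rw [h3, h5, ENNReal.mul_inv_cancel hc0 hct]; ring
      _ = (translationSq U (r • e) * (‖r‖ₑ ^ (3 : ℝ) * 8⁻¹ * c)) *
            (‖r‖ₑ ^ (-(1 + 2 * s)) * ‖r‖ₑ ^ (-3 : ℝ)) * 8 * c⁻¹ := by ring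
      _ ≤ (4 * ∫⁻ h : R3 in {h | ‖h‖ₑ ≤ ‖r‖ₑ}, translationSq U h) *
            (‖r‖ₑ ^ (-(1 + 2 * s)) * ‖r‖ₑ ^ (-3 : ℝ)) * 8 * c⁻¹ := by gcongr
      _ = _ := by rw [h4]; ring
  have hmi : Measurable fun q : ℝ × R3 =>
      indicator {r : ℝ | ‖q.2‖ₑ ≤ ‖r‖ₑ} (fun r => ‖r‖ₑ ^ (-(1 + (3 + 2 * s)))) q.1 :=
    (measurable_fst.enorm.pow_const (-(1 + (3 + 2 * s)))).indicator
      (measurableSet_le measurable_snd.enorm measurable_fst.enorm)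
  have hmi2 : Measurable fun q : ℝ × R3 => translationSq U q.2 *
      indicator {r : ℝ | ‖q.2‖ₑ ≤ ‖r‖ₑ} (fun r => ‖r‖ₑ ^ (-(1 + (3 + 2 * s)))) q.1 :=
    (hω.comp measurable_snd).mul hmi
  have hne : ∀ᵐ r : ℝ, r ≠ 0 := by simp [ae_iff]
  calc ∫⁻ r : ℝ, translationSq U (r • e) * ‖r‖ₑ ^ (-(1 + 2 * s))
      ≤ ∫⁻ r : ℝ, (32 * c⁻¹) * ∫⁻ h : R3, translationSq U h *
        indicator {r : ℝ | ‖h‖ₑ ≤ ‖r‖ₑ} (fun r => ‖r‖ₑ ^ (-(1 + (3 + 2 * s)))) r :=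
        lintegral_mono_ae (hne.mono hpt)
    _ = (32 * c⁻¹) * ∫⁻ h : R3, ∫⁻ r : ℝ, translationSq U h *
        indicator {r : ℝ | ‖h‖ₑ ≤ ‖r‖ₑ} (fun r => ‖r‖ₑ ^ (-(1 + (3 + 2 * s)))) r := by
        rw [lintegral_const_mul _ hmi2.lintegral_prod_right', lintegral_lintegral_swap
          hmi2.aemeasurable]
    _ ≤ (32 * c⁻¹) * ∫⁻ h : R3, C * (translationSq U h * ‖h‖ₑ ^ (-(3 + 2 * s))) := by
        gcongr with h
        have hmh : Measurable
            (indicator {r : ℝ | ‖h‖ₑ ≤ ‖r‖ₑ} (fun r => ‖r‖ₑ ^ (-(1 + (3 + 2 * s))))) :=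
          (measurable_enorm.pow_const _).indicator
            (measurableSet_le measurable_const measurable_enorm)
        rw [lintegral_const_mul _ hmh, lintegral_indicator
          (measurableSet_le measurable_const measurable_enorm), mul_left_comm]
        gcongr
        simpa using hC ‖h‖ₑ
    _ = _ := by
        have hmk : Measurable fun h : R3 => translationSq U h * ‖h‖ₑ ^ (-(3 + 2 * s)) :=
          hω.mul (measurable_enorm.pow_const _)
        rw [lintegral_const_mul _ hmk,
          gagliardoSq_eq_lintegral_translationSq hU hs.ne']
        push_cast
        rw [ENNReal.coe_toNNReal (ENNReal.inv_ne_top.2 hc0)]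
        ring

end Translation

/-- Absorption of the last term. It needs `I` finite, which is why the Hardy weight is first
truncated. -/
theorem le_mul_of_le_add_mul {I J : ℝ≥0∞} {κ : ℝ≥0} (hκ : κ < 1) (hI : I ≠ ∞)
    (h : I ≤ J + κ * I) : I ≤ ((1 - κ)⁻¹ : ℝ≥0) * J := by
  rcases eq_or_ne J ∞ with rfl | hJ
  · have h0 : ((1 - κ)⁻¹ : ℝ≥0) ≠ 0 := inv_ne_zero (tsub_pos_of_lt hκ).ne'
    rw [ENNReal.mul_top (by exact_mod_cast h0)]
    exact le_top
  lift I to ℝ≥0 using hI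
  lift J to ℝ≥0 using hJ
  norm_cast at h ⊢
  have hκ' : (κ : ℝ) < 1 := hκ
  rw [← NNReal.coe_le_coe] at h ⊢
  push_cast [NNReal.coe_sub hκ.le] at h ⊢
  rw [inv_mul_eq_div, le_div_iff₀ (by linarith)]
  linarith

theorem exists_pos_one_add_mul_lt_one {θ : ℝ≥0} (hθ : θ < 1) :
    ∃ ε : ℝ≥0, ε ≠ 0 ∧ (1 + ε) * θ < 1 := by
  have h : (0 : ℝ) < 1 - θ := sub_pos.2 hθ
  -- For this `ε`, `1 - (1 + ε) θ = (1 - θ)(2 - θ) / 2 > 0`.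
  refine ⟨((1 - θ) / 2 : ℝ).toNNReal, (Real.toNNReal_pos.2 (by linarith)).ne', ?_⟩
  rw [← NNReal.coe_lt_coe]
  push_cast
  rw [Real.coe_toNNReal _ (by linarith)]
  nlinarith [θ.coe_nonneg]

/-! ### The fractional Hardy inequality on the line. -/

section Line

/-- The singular weight `|z| ^ (-2s)`, truncated at height `N`. -/
noncomputable def truncWeight (s : ℝ) (N : ℕ) (z : ℝ) : ℝ≥0∞ := min (‖z‖ₑ ^ (-(2 * s))) N

theorem measurable_truncWeight (s : ℝ) (N : ℕ) : Measurable (truncWeight s N) :=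
  (measurable_enorm.pow_const _).min measurable_const

/-- The untruncated weight scales by exactly `c ^ (2s)`; this factor is at least 1, so the cap `N`
respects the inequality. -/
theorem truncWeight_inv_mul_le {s : ℝ} (hs : 0 ≤ s) (N : ℕ) {c : ℝ} (hc : 1 ≤ c) (z : ℝ) :
    truncWeight s N (c⁻¹ * z) ≤ ENNReal.ofReal (c ^ (2 * s)) * truncWeight s N z := by
  have hc0 : 0 < c := by linarith
  have h1 : (1 : ℝ≥0∞) ≤ ENNReal.ofReal (c ^ (2 * s)) :=
    ENNReal.one_le_ofReal.2 (Real.one_le_rpow hc (by linarith))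
  have h2 : ‖c⁻¹ * z‖ₑ ^ (-(2 * s)) = ENNReal.ofReal (c ^ (2 * s)) * ‖z‖ₑ ^ (-(2 * s)) := by
    have hci : ‖c⁻¹‖ₑ = ENNReal.ofReal c⁻¹ := Real.enorm_of_nonneg (by positivity)
    have hpos : 0 < c⁻¹ := by positivity
    rw [enorm_mul, ENNReal.mul_rpow_of_ne_top enorm_ne_top enorm_ne_top, hci,
      ENNReal.ofReal_rpow_of_pos hpos, Real.inv_rpow hc0.le, Real.rpow_neg hc0.le, inv_inv]
  rw [truncWeight, truncWeight, h2, mul_min]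
  exact min_le_min le_rfl (le_mul_of_one_le_left' h1)

variable {F : Type*} [NormedAddCommGroup F] {f : ℝ → F}

/-- The Jacobian `c⁻¹` beats the growth `c ^ (2s)` of the weight. For `s < 1/2` the resulting factor
is below 1, uniformly in `N`: this is the contraction behind Hardy's inequality. -/
theorem lintegral_truncWeight_dilation_le (hf : StronglyMeasurable f) {s : ℝ} (hs : 0 ≤ s)
    (hs' : s ≤ 1 / 2) (N : ℕ) {c : ℝ} (hc : 2 ≤ c) :
    ∫⁻ z : ℝ, truncWeight s N z * ‖f (c * z)‖ₑ ^ 2 ≤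
      ENNReal.ofReal (2 ^ (2 * s - 1)) * ∫⁻ z : ℝ, truncWeight s N z * ‖f z‖ₑ ^ 2 := by
  have hc0 : 0 < c := by linarith
  have h1 := lintegral_comp_smul (volume : Measure ℝ)
    (fun w => truncWeight s N (c⁻¹ * w) * ‖f w‖ₑ ^ 2) hc0.ne'
  have hmW : Measurable fun z : ℝ => truncWeight s N z * ‖f z‖ₑ ^ 2 :=
    (measurable_truncWeight s N).mul (hf.enorm.pow_const 2)
  simp only [smul_eq_mul, inv_mul_cancel_left₀ hc0.ne', Module.finrank_self, pow_one] at h1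
  rw [h1, abs_of_pos (by positivity)]
  calc ENNReal.ofReal c⁻¹ * ∫⁻ w, truncWeight s N (c⁻¹ * w) * ‖f w‖ₑ ^ 2
      ≤ ENNReal.ofReal c⁻¹ * ∫⁻ w, ENNReal.ofReal (c ^ (2 * s)) *
          (truncWeight s N w * ‖f w‖ₑ ^ 2) := by
        refine mul_le_mul' le_rfl (lintegral_mono fun w => ?_)
        rw [← mul_assoc]
        exact mul_le_mul' (truncWeight_inv_mul_le hs N (by linarith) w) le_rfl
    _ = ENNReal.ofReal (c ^ (2 * s - 1)) * ∫⁻ w, truncWeight s N w * ‖f w‖ₑ ^ 2 := by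
        rw [lintegral_const_mul _ hmW, ← mul_assoc, ← ENNReal.ofReal_mul (by positivity),
          Real.rpow_sub_one hc0.ne', inv_mul_eq_div]
    _ ≤ _ := by
        gcongr ENNReal.ofReal ?_ * _
        exact Real.rpow_le_rpow_of_nonpos (by norm_num) hc (by linarith)

/-- Compare `f z` with `f` at the dilated point `z + m z = (1 + m) z`. Truncation is kept only in
the term to be absorbed. -/
theorem lintegral_truncWeight_le_add (hf : StronglyMeasurable f) {s : ℝ} (hs : 0 ≤ s)
    (hs' : s ≤ 1 / 2) (N : ℕ) {m : ℝ} (hm : 1 ≤ m) {ε : ℝ≥0} (hε : ε ≠ 0) :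
    ∫⁻ z : ℝ, truncWeight s N z * ‖f z‖ₑ ^ 2 ≤
      ((1 + ε⁻¹ : ℝ≥0) : ℝ≥0∞) * (∫⁻ z : ℝ, ‖z‖ₑ ^ (-(2 * s)) * ‖f (z + m * z) - f z‖ₑ ^ 2) +
        ((1 + ε : ℝ≥0) : ℝ≥0∞) * (ENNReal.ofReal (2 ^ (2 * s - 1)) *
          ∫⁻ z : ℝ, truncWeight s N z * ‖f z‖ₑ ^ 2) := by
  have hdil := hf.comp_measurable (measurable_const_mul (1 + m))
  have hfm : StronglyMeasurable fun z : ℝ => f (z + m * z) := by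
    simpa only [Function.comp_def, add_mul, one_mul] using hdil
  have hm1 : Measurable fun z : ℝ => truncWeight s N z * ‖f (z + m * z)‖ₑ ^ 2 :=
    (measurable_truncWeight s N).mul (hfm.enorm.pow_const 2)
  have hm2 : Measurable fun z : ℝ => ‖z‖ₑ ^ (-(2 * s)) * ‖f (z + m * z) - f z‖ₑ ^ 2 :=
    (measurable_enorm.pow_const _).mul ((hfm.sub hf).enorm.pow_const 2)
  have hd := lintegral_truncWeight_dilation_le hf hs hs' N (c := 1 + m) (by linarith)
  simp only [add_mul, one_mul] at hd
  refine le_trans ?_ (add_le_add_right (mul_le_mul_right hd _) _)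
  rw [← lintegral_const_mul _ hm1, ← lintegral_const_mul _ hm2,
    ← lintegral_add_right _ (hm1.const_mul _)]
  refine lintegral_mono fun z => ?_
  have htri : ‖f z‖ₑ ≤ ‖f (z + m * z) - f z‖ₑ + ‖f (z + m * z)‖ₑ := by
    have h := enorm_add_le (f z - f (z + m * z)) (f (z + m * z))
    rwa [sub_add_cancel, ← edist_eq_enorm_sub, edist_comm, edist_eq_enorm_sub] at h
  have hy := (pow_le_pow_left₀ zero_le htri 2).trans (add_sq_le_young _ _ hε)
  calc truncWeight s N z * ‖f z‖ₑ ^ 2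
      ≤ truncWeight s N z * (((1 + ε⁻¹ : ℝ≥0) : ℝ≥0∞) * ‖f (z + m * z) - f z‖ₑ ^ 2 +
          ((1 + ε : ℝ≥0) : ℝ≥0∞) * ‖f (z + m * z)‖ₑ ^ 2) := by gcongr
    _ = ((1 + ε⁻¹ : ℝ≥0) : ℝ≥0∞) * (truncWeight s N z * ‖f (z + m * z) - f z‖ₑ ^ 2) +
          ((1 + ε : ℝ≥0) : ℝ≥0∞) * (truncWeight s N z * ‖f (z + m * z)‖ₑ ^ 2) := by ring
    _ ≤ _ := by
        gcongr
        exact min_le_left _ _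

/-- Averaging over the dilation parameter turns dilation differences into translation differences:
put `r = m z`, so `dm = dr / |z|`. The 4 bounds `m ^ (1 + 2s)`, since `m ≤ 2` and `1 + 2s ≤ 2`. -/
theorem setLIntegral_Icc_dilation_le {s : ℝ} (hs' : s ≤ 1 / 2) {G : ℝ → ℝ≥0∞}
    (hG : Measurable G) {z : ℝ} (hz : z ≠ 0) :
    ∫⁻ m in Icc (1 : ℝ) 2, ‖z‖ₑ ^ (-(2 * s)) * G (m * z) ≤
      4 * ∫⁻ r : ℝ, G r * ‖r‖ₑ ^ (-(1 + 2 * s)) := by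
  have hz0 : ‖z‖ₑ ≠ 0 := by simpa using hz
  have hmH : Measurable fun r : ℝ => G r * ‖r‖ₑ ^ (-(1 + 2 * s)) :=
    hG.mul (measurable_enorm.pow_const _)
  have hmHz : Measurable fun m : ℝ => G (m * z) * ‖m * z‖ₑ ^ (-(1 + 2 * s)) :=
    hmH.comp (measurable_mul_const z)
  have hchange := lintegral_comp_smul (volume : Measure ℝ)
    (fun r => G r * ‖r‖ₑ ^ (-(1 + 2 * s))) hz
  simp only [smul_eq_mul, Module.finrank_self, pow_one, mul_comm z] at hchange
  have hzinv : ENNReal.ofReal |z⁻¹| = ‖z‖ₑ⁻¹ := by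
    rw [abs_inv, ENNReal.ofReal_inv_of_pos (abs_pos.2 hz), ← Real.norm_eq_abs, ofReal_norm]
  calc ∫⁻ m in Icc (1 : ℝ) 2, ‖z‖ₑ ^ (-(2 * s)) * G (m * z)
      ≤ ∫⁻ m in Icc (1 : ℝ) 2, (4 * ‖z‖ₑ) * (G (m * z) * ‖m * z‖ₑ ^ (-(1 + 2 * s))) := by
        refine setLIntegral_mono' measurableSet_Icc fun m hm => ?_
        have hm1 : ‖m‖ₑ = ENNReal.ofReal m := Real.enorm_of_nonneg (by linarith [hm.1])
        have hm0 : 0 < m := by linarith [hm.1]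
        have hpow : (1 : ℝ≥0∞) ≤ 4 * ‖m‖ₑ ^ (-(1 + 2 * s)) := by
          rw [hm1, ENNReal.ofReal_rpow_of_pos hm0,
            show (4 : ℝ≥0∞) = ENNReal.ofReal 4 by norm_num, ← ENNReal.ofReal_mul (by norm_num),
            ENNReal.one_le_ofReal]
          have h4 : m ^ (1 + 2 * s) ≤ 4 := by
            calc m ^ (1 + 2 * s) ≤ m ^ (2 : ℝ) :=
                  Real.rpow_le_rpow_of_exponent_le hm.1 (by linarith)
              _ = m ^ 2 := Real.rpow_two m
              _ ≤ 4 := by nlinarith [hm.1, hm.2]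
          rw [Real.rpow_neg hm0.le, ← div_eq_mul_inv, le_div_iff₀ (by positivity)]
          linarith
        have hzz : ‖z‖ₑ * ‖z‖ₑ ^ (-(1 + 2 * s)) = ‖z‖ₑ ^ (-(2 * s)) := by
          nth_rewrite 1 [← ENNReal.rpow_one ‖z‖ₑ]
          rw [← ENNReal.rpow_add _ _ hz0 enorm_ne_top]
          ring_nf
        rw [enorm_mul, ENNReal.mul_rpow_of_ne_top enorm_ne_top enorm_ne_top]
        calc ‖z‖ₑ ^ (-(2 * s)) * G (m * z) = 1 * (‖z‖ₑ ^ (-(2 * s)) * G (m * z)) := by ring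
          _ ≤ (4 * ‖m‖ₑ ^ (-(1 + 2 * s))) *
              ((‖z‖ₑ * ‖z‖ₑ ^ (-(1 + 2 * s))) * G (m * z)) := by
              rw [hzz]
              gcongr
          _ = _ := by ring
    _ ≤ ∫⁻ m, (4 * ‖z‖ₑ) * (G (m * z) * ‖m * z‖ₑ ^ (-(1 + 2 * s))) :=
        setLIntegral_le_lintegral _ _
    _ = 4 * (‖z‖ₑ * ‖z‖ₑ⁻¹) * ∫⁻ r : ℝ, G r * ‖r‖ₑ ^ (-(1 + 2 * s)) := by
        rw [lintegral_const_mul _ hmHz, hchange, hzinv]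
        ring
    _ = _ := by rw [ENNReal.mul_inv_cancel hz0 enorm_ne_top, mul_one]

theorem lintegral_Icc_difference_le (hf : StronglyMeasurable f) {s : ℝ} (hs' : s ≤ 1 / 2) :
    ∫⁻ m in Icc (1 : ℝ) 2, ∫⁻ z : ℝ, ‖z‖ₑ ^ (-(2 * s)) * ‖f (z + m * z) - f z‖ₑ ^ 2 ≤
      4 * ∫⁻ z : ℝ, ∫⁻ r : ℝ, ‖f (z + r) - f z‖ₑ ^ 2 * ‖r‖ₑ ^ (-(1 + 2 * s)) := by
  have h1 := hf.comp_measurable (show Measurable fun q : ℝ × ℝ => q.2 + q.1 * q.2 by fun_prop)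
  have h2 := hf.comp_measurable (show Measurable fun q : ℝ × ℝ => q.2 by fun_prop)
  have h3 : Measurable fun q : ℝ × ℝ => ‖q.2‖ₑ ^ (-(2 * s)) :=
    measurable_snd.enorm.pow_const _
  have hmeas : Measurable fun q : ℝ × ℝ =>
      ‖q.2‖ₑ ^ (-(2 * s)) * ‖f (q.2 + q.1 * q.2) - f q.2‖ₑ ^ 2 :=
    h3.mul ((h1.sub h2).enorm.pow_const 2)
  rw [lintegral_lintegral_swap hmeas.aemeasurable]
  refine (lintegral_mono_ae ?_).trans (lintegral_const_mul' _ _ (by norm_num)).le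
  have hne : ∀ᵐ z : ℝ, z ≠ 0 := by simp [ae_iff]
  filter_upwards [hne] with z hz
  have h4 := hf.comp_measurable (measurable_const_add z)
  exact setLIntegral_Icc_dilation_le hs' ((h4.sub stronglyMeasurable_const).enorm.pow_const 2) hz

theorem lintegral_truncWeight_ne_top {s : ℝ} (N : ℕ) (hfin : ∫⁻ z : ℝ, ‖f z‖ₑ ^ 2 ≠ ∞) :
    ∫⁻ z : ℝ, truncWeight s N z * ‖f z‖ₑ ^ 2 ≠ ∞ := by
  refine ne_top_of_le_ne_top (ENNReal.mul_ne_top (ENNReal.natCast_ne_top N) hfin) ?_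
  rw [← lintegral_const_mul' _ _ (ENNReal.natCast_ne_top N)]
  refine lintegral_mono fun z => ?_
  gcongr
  exact min_le_right _ _

theorem lintegral_weight_eq_iSup (hf : StronglyMeasurable f) (s : ℝ) :
    ∫⁻ z : ℝ, ‖z‖ₑ ^ (-(2 * s)) * ‖f z‖ₑ ^ 2 =
      ⨆ N : ℕ, ∫⁻ z : ℝ, truncWeight s N z * ‖f z‖ₑ ^ 2 := by
  rw [← lintegral_iSup]
  · refine lintegral_congr fun z => ?_
    rw [← ENNReal.iSup_mul]
    congr 1
    simp only [truncWeight]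
    rw [← inf_iSup_eq, ENNReal.iSup_natCast, inf_top_eq]
  · exact fun N => (measurable_truncWeight s N).mul (hf.enorm.pow_const 2)
  · intro N M hNM z
    have : (N : ℝ≥0∞) ≤ M := by exact_mod_cast hNM
    simp only [truncWeight]
    gcongr

/-- The fractional Hardy inequality on the line, of order `s < 1 / 2`. -/
theorem exists_hardy_line {s : ℝ} (hs : 0 ≤ s) (hs' : s < 1 / 2) :
    ∃ C : ℝ≥0, ∀ {F : Type*} [NormedAddCommGroup F] {f : ℝ → F}, StronglyMeasurable f → ∀ a : ℝ,
      ∫⁻ z : ℝ, ‖z - a‖ₑ ^ (-(2 * s)) * ‖f z‖ₑ ^ 2 ≤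
        C * ((∫⁻ z : ℝ, ‖f z‖ₑ ^ 2) +
          ∫⁻ z : ℝ, ∫⁻ r : ℝ, ‖f (z + r) - f z‖ₑ ^ 2 * ‖r‖ₑ ^ (-(1 + 2 * s))) := by
  have hθ : ((2 : ℝ) ^ (2 * s - 1)).toNNReal < 1 := by
    rw [Real.toNNReal_lt_one]
    exact Real.rpow_lt_one_of_one_lt_of_neg (by norm_num) (by linarith)
  obtain ⟨ε, hε, hκ⟩ := exists_pos_one_add_mul_lt_one hθ
  set θ := ((2 : ℝ) ^ (2 * s - 1)).toNNReal with hθdef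
  -- The factors come from absorption, Young's inequality and the average over `m`. The final 1
  -- makes the constant visibly nonzero, which settles the case of infinite `L²` norm, where
  -- absorption is unavailable.
  refine ⟨(1 - (1 + ε) * θ)⁻¹ * ((1 + ε⁻¹) * 4) + 1, fun {F} _ {f} hf a => ?_⟩
  by_cases hfin : ∫⁻ z : ℝ, ‖f z‖ₑ ^ 2 = ∞
  · rw [hfin, top_add, ENNReal.mul_top (by simp)]
    exact le_top
  set g : ℝ → F := fun z => f (z + a) with hg
  have hgm : StronglyMeasurable g := hf.comp_measurable (measurable_add_const a)
  have hshift : ∫⁻ z : ℝ, ‖z - a‖ₑ ^ (-(2 * s)) * ‖f z‖ₑ ^ 2 =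
      ∫⁻ z : ℝ, ‖z‖ₑ ^ (-(2 * s)) * ‖g z‖ₑ ^ 2 := by
    rw [← lintegral_add_right_eq_self (fun z => ‖z - a‖ₑ ^ (-(2 * s)) * ‖f z‖ₑ ^ 2) a]
    simp only [add_sub_cancel_right, hg]
  have hshift2 : ∫⁻ z : ℝ, ∫⁻ r : ℝ, ‖g (z + r) - g z‖ₑ ^ 2 * ‖r‖ₑ ^ (-(1 + 2 * s)) =
      ∫⁻ z : ℝ, ∫⁻ r : ℝ, ‖f (z + r) - f z‖ₑ ^ 2 * ‖r‖ₑ ^ (-(1 + 2 * s)) := by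
    rw [← lintegral_add_right_eq_self
      (fun z => ∫⁻ r : ℝ, ‖f (z + r) - f z‖ₑ ^ 2 * ‖r‖ₑ ^ (-(1 + 2 * s))) a]
    simp only [hg, add_right_comm]
  have hgfin : ∫⁻ z : ℝ, ‖g z‖ₑ ^ 2 ≠ ∞ := by
    rwa [lintegral_add_right_eq_self (fun z => ‖f z‖ₑ ^ 2) a]
  rw [hshift, ← hshift2, lintegral_weight_eq_iSup hgm]
  refine iSup_le fun N => ?_
  set J := ∫⁻ z : ℝ, ∫⁻ r : ℝ, ‖g (z + r) - g z‖ₑ ^ 2 * ‖r‖ₑ ^ (-(1 + 2 * s))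
  set I := ∫⁻ z : ℝ, truncWeight s N z * ‖g z‖ₑ ^ 2
  have hone : volume (Icc (1 : ℝ) 2) = 1 := by rw [Real.volume_Icc]; norm_num
  have hI : I ≤ ((1 + ε⁻¹ : ℝ≥0) : ℝ≥0∞) * (4 * J) + (((1 + ε) * θ : ℝ≥0) : ℝ≥0∞) * I := by
    -- The interval has length 1, so averaging over `m` leaves `I` unchanged.
    calc I = ∫⁻ _ in Icc (1 : ℝ) 2, I := by rw [setLIntegral_const, hone, mul_one]
      _ ≤ ∫⁻ m in Icc (1 : ℝ) 2, (((1 + ε⁻¹ : ℝ≥0) : ℝ≥0∞) *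
            (∫⁻ z : ℝ, ‖z‖ₑ ^ (-(2 * s)) * ‖g (z + m * z) - g z‖ₑ ^ 2) +
            (((1 + ε) * θ : ℝ≥0) : ℝ≥0∞) * I) := by
          refine setLIntegral_mono' measurableSet_Icc fun m hm => ?_
          rw [ENNReal.coe_mul, mul_assoc]
          exact lintegral_truncWeight_le_add hgm hs hs'.le N hm.1 hε
      _ = ((1 + ε⁻¹ : ℝ≥0) : ℝ≥0∞) * (∫⁻ m in Icc (1 : ℝ) 2,
            ∫⁻ z : ℝ, ‖z‖ₑ ^ (-(2 * s)) * ‖g (z + m * z) - g z‖ₑ ^ 2) +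
            (((1 + ε) * θ : ℝ≥0) : ℝ≥0∞) * I := by
          rw [lintegral_add_right _ measurable_const, setLIntegral_const, hone, mul_one,
            lintegral_const_mul' _ _ ENNReal.coe_ne_top]
      _ ≤ _ := by
          gcongr
          exact lintegral_Icc_difference_le hgm hs'.le
  calc I ≤ ((1 - (1 + ε) * θ)⁻¹ : ℝ≥0) * (((1 + ε⁻¹ : ℝ≥0) : ℝ≥0∞) * (4 * J)) :=
        le_mul_of_le_add_mul hκ (lintegral_truncWeight_ne_top N hgfin) hI
    _ = (((1 - (1 + ε) * θ)⁻¹ * ((1 + ε⁻¹) * 4) : ℝ≥0) : ℝ≥0∞) * J := by push_cast; ring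
    _ ≤ _ := by
        gcongr
        · exact_mod_cast le_self_add
        · exact le_add_self

end Line

/-! ### Hardy inequalities in space, line by line. -/

section Slicing

/-- The point of `ℝ³` whose `i`-th coordinate is `z` and whose other coordinates are `y`. -/
def slicePoint (i : Fin 3) (z : ℝ) (y : Fin 2 → ℝ) : R3 := WithLp.toLp 2 (i.insertNth z y)

theorem slicePoint_add (i : Fin 3) (z r : ℝ) (y : Fin 2 → ℝ) :
    slicePoint i (z + r) y = slicePoint i z y + r • EuclideanSpace.single i 1 := by
  ext j
  rcases Fin.eq_self_or_eq_succAbove i j with rfl | ⟨k, rfl⟩ <;> simp [slicePoint]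

theorem measurePreserving_slicePoint (i : Fin 3) :
    MeasurePreserving (fun q : (Fin 2 → ℝ) × ℝ => slicePoint i q.2 q.1) := by
  have h1 := (volume_preserving_piFinSuccAbove (fun _ : Fin 3 => ℝ) i).symm
  have h2 := PiLp.volume_preserving_toLp (Fin 3)
  exact (h2.comp h1).comp Measure.measurePreserving_swap

theorem lintegral_eq_lintegral_slice (i : Fin 3) {G : R3 → ℝ≥0∞} (hG : Measurable G) :
    ∫⁻ p, G p = ∫⁻ y : Fin 2 → ℝ, ∫⁻ z : ℝ, G (slicePoint i z y) := by
  have h := measurePreserving_slicePoint i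
  rw [← h.lintegral_comp hG]
  exact lintegral_prod _ (hG.comp h.measurable).aemeasurable

variable {F : Type*} [NormedAddCommGroup F] {U : R3 → F}

theorem measurable_direction_integrand (hU : StronglyMeasurable U) (e : R3) (s : ℝ) :
    Measurable fun q : R3 × ℝ => ‖U (q.1 + q.2 • e) - U q.1‖ₑ ^ 2 * ‖q.2‖ₑ ^ (-(1 + 2 * s)) := by
  have h1 := hU.comp_measurable (show Measurable fun q : R3 × ℝ => q.1 + q.2 • e by fun_prop)
  have h2 := hU.comp_measurable (show Measurable fun q : R3 × ℝ => q.1 by fun_prop)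
  have h3 : Measurable fun q : R3 × ℝ => ‖q.2‖ₑ ^ (-(1 + 2 * s)) :=
    measurable_snd.enorm.pow_const _
  exact ((h1.sub h2).enorm.pow_const 2).mul h3

theorem lintegral_slice_difference_eq (hU : StronglyMeasurable U) (i : Fin 3) (s : ℝ) :
    ∫⁻ y : Fin 2 → ℝ, ∫⁻ z : ℝ, ∫⁻ r : ℝ,
        ‖U (slicePoint i (z + r) y) - U (slicePoint i z y)‖ₑ ^ 2 * ‖r‖ₑ ^ (-(1 + 2 * s)) =
      ∫⁻ r : ℝ, translationSq U (r • EuclideanSpace.single i 1) * ‖r‖ₑ ^ (-(1 + 2 * s)) := by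
  have hm := measurable_direction_integrand hU (EuclideanSpace.single i (1 : ℝ)) s
  simp only [slicePoint_add]
  rw [← lintegral_eq_lintegral_slice i (G := fun p => ∫⁻ r : ℝ,
    ‖U (p + r • EuclideanSpace.single i 1) - U p‖ₑ ^ 2 * ‖r‖ₑ ^ (-(1 + 2 * s)))
    hm.lintegral_prod_right', lintegral_lintegral_swap hm.aemeasurable]
  refine lintegral_congr fun r => ?_
  rw [translationSq, lintegral_mul_const _ (measurable_translation_integrand_left hU _)]

/-- The fractional Hardy inequality in `ℝ³`, of order `s < 1 / 2`, with respect to the distance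
to a hypersurface measured in the direction of a coordinate axis. The hypersurface is the graph
of an arbitrary measurable function `g` of the other two coordinates. -/
theorem exists_hardy_graph {s : ℝ} (hs : 0 < s) (hs' : s < 1 / 2) :
    ∃ C : ℝ≥0, ∀ {F : Type*} [NormedAddCommGroup F] {U : R3 → F}, StronglyMeasurable U →
      ∀ (i : Fin 3) {g : R3 → ℝ}, Measurable g →
        (∀ p (r : ℝ), g (p + r • EuclideanSpace.single i 1) = g p) →
        ∫⁻ p : R3, ‖p i - g p‖ₑ ^ (-(2 * s)) * ‖U p‖ₑ ^ 2 ≤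
          C * ((∫⁻ p : R3, ‖U p‖ₑ ^ 2) + gagliardoSq s U) := by
  obtain ⟨C₁, hC₁⟩ := exists_hardy_line hs.le hs'
  obtain ⟨C₂, hC₂⟩ := exists_lintegral_direction_le hs
  refine ⟨C₁ * (1 + C₂), fun {F} _ {U} hU i {g} hg hgi => ?_⟩
  have hm2 : Measurable fun p : R3 => ‖U p‖ₑ ^ 2 := hU.enorm.pow_const 2
  have hmc : Measurable fun p : R3 => p i - g p := by fun_prop
  have hm1 : Measurable fun p : R3 => ‖p i - g p‖ₑ ^ (-(2 * s)) * ‖U p‖ₑ ^ 2 :=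
    (hmc.enorm.pow_const _).mul hm2
  have hline : ∀ y : Fin 2 → ℝ, ∫⁻ z : ℝ, ‖slicePoint i z y i - g (slicePoint i z y)‖ₑ ^ (-(2 * s)) *
      ‖U (slicePoint i z y)‖ₑ ^ 2 ≤ C₁ * ((∫⁻ z : ℝ, ‖U (slicePoint i z y)‖ₑ ^ 2) +
        ∫⁻ z : ℝ, ∫⁻ r : ℝ, ‖U (slicePoint i (z + r) y) - U (slicePoint i z y)‖ₑ ^ 2 *
          ‖r‖ₑ ^ (-(1 + 2 * s))) := by
    intro y
    have hi : ∀ z, slicePoint i z y i = z := fun z => by simp [slicePoint]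
    -- On each line `g` is constant, so the singularity sits at one point and the one-dimensional
    -- inequality applies with that centre.
    have hgz : ∀ z, g (slicePoint i z y) = g (slicePoint i 0 y) := fun z => by
      rw [← hgi (slicePoint i 0 y) z, ← slicePoint_add, zero_add]
    simp only [hi, hgz]
    have hsl : Measurable fun z : ℝ => slicePoint i z y :=
      (measurePreserving_slicePoint i).measurable.comp measurable_prodMk_left
    exact hC₁ (hU.comp_measurable hsl) _
  have he : ‖(EuclideanSpace.single i (1 : ℝ) : R3)‖ = 1 := by simp
  have hslm : Measurable fun y : Fin 2 → ℝ => ∫⁻ z : ℝ, ‖U (slicePoint i z y)‖ₑ ^ 2 := by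
    have h := hm2.comp (measurePreserving_slicePoint i).measurable
    exact h.lintegral_prod_right'
  calc ∫⁻ p : R3, ‖p i - g p‖ₑ ^ (-(2 * s)) * ‖U p‖ₑ ^ 2
      = ∫⁻ y : Fin 2 → ℝ, ∫⁻ z : ℝ, ‖slicePoint i z y i - g (slicePoint i z y)‖ₑ ^ (-(2 * s)) *
          ‖U (slicePoint i z y)‖ₑ ^ 2 := lintegral_eq_lintegral_slice i hm1
    _ ≤ ∫⁻ y : Fin 2 → ℝ, C₁ * ((∫⁻ z : ℝ, ‖U (slicePoint i z y)‖ₑ ^ 2) +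
        ∫⁻ z : ℝ, ∫⁻ r : ℝ, ‖U (slicePoint i (z + r) y) - U (slicePoint i z y)‖ₑ ^ 2 *
          ‖r‖ₑ ^ (-(1 + 2 * s))) := lintegral_mono hline
    _ = C₁ * ((∫⁻ p : R3, ‖U p‖ₑ ^ 2) + ∫⁻ r : ℝ,
          translationSq U (r • EuclideanSpace.single i 1) * ‖r‖ₑ ^ (-(1 + 2 * s))) := by
        rw [lintegral_const_mul' _ _ ENNReal.coe_ne_top, lintegral_add_left hslm,
          lintegral_slice_difference_eq hU, ← lintegral_eq_lintegral_slice i hm2]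
    _ ≤ C₁ * ((∫⁻ p : R3, ‖U p‖ₑ ^ 2) + C₂ * gagliardoSq s U) := by
        gcongr
        exact hC₂ hU _ he
    _ ≤ C₁ * ((1 + C₂) * (∫⁻ p : R3, ‖U p‖ₑ ^ 2) + (1 + C₂) * gagliardoSq s U) := by
        gcongr
        · exact le_mul_of_one_le_left' le_self_add
        · exact le_add_self
    _ = _ := by push_cast; ring

end Slicing

/-! ### Distance from points of the subgraph to its complement. -/

section Geometry

/-- The height function `η`, viewed as a function on `ℝ³`. -/
def height (η : Torus2 → ℝ) (p : R3) : ℝ := η ((p 0 : UnitAddCircle), (p 1 : UnitAddCircle))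

/-- The coordinate directions transversal to the six faces of the subgraph. -/
def faceDir : Fin 6 → Fin 3 := ![0, 0, 1, 1, 2, 2]

/-- The six faces of the subgraph are contained in the graphs of these functions, taken over the
coordinate directions `faceDir`. -/
def faceLevel (η : Torus2 → ℝ) : Fin 6 → R3 → ℝ :=
  ![fun _ => 0, fun _ => 1, fun _ => 0, fun _ => 1, fun _ => 0, height η]

variable {η : Torus2 → ℝ}

theorem measurable_height (hη : Continuous η) : Measurable (height η) := by
  have h : Continuous fun p : R3 => ((p 0 : UnitAddCircle), (p 1 : UnitAddCircle)) :=
    ((AddCircle.continuous_mk' 1).comp (EuclideanSpace.proj (𝕜 := ℝ) (0 : Fin 3)).continuous).prodMk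
      ((AddCircle.continuous_mk' 1).comp (EuclideanSpace.proj (𝕜 := ℝ) (1 : Fin 3)).continuous)
  exact (hη.comp h).measurable

theorem measurableSet_subgraph (hη : Continuous η) : MeasurableSet (subgraph η) := by
  have hc : ∀ i : Fin 3, Measurable fun p : R3 => p i := fun i => by fun_prop
  exact ((hc 0) measurableSet_Ico).inter (((hc 1) measurableSet_Ico).inter
    ((measurableSet_lt measurable_const (hc 2)).inter
      (measurableSet_lt (hc 2) (measurable_height hη))))

theorem measurable_faceLevel (hη : Continuous η) (j : Fin 6) : Measurable (faceLevel η j) := by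
  fin_cases j
  all_goals first | exact measurable_const | exact measurable_height hη

theorem faceLevel_add_smul (j : Fin 6) (p : R3) (r : ℝ) :
    faceLevel η j (p + r • EuclideanSpace.single (faceDir j) 1) = faceLevel η j p := by
  fin_cases j
  all_goals first | rfl | simp [faceLevel, faceDir, height]

theorem dist_unitAddCircle_coe_le (a b : ℝ) : dist (a : UnitAddCircle) (b : UnitAddCircle) ≤ |a - b| := by
  rw [dist_eq_norm, ← AddCircle.coe_sub]
  exact QuotientAddGroup.norm_mk_le_norm

theorem abs_sub_apply_le_dist (p q : R3) (i : Fin 3) : |p i - q i| ≤ dist q p := by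
  rw [dist_comm, dist_eq_norm, ← Real.norm_eq_abs]
  exact PiLp.norm_apply_le (p - q) i

/-- The quotient map to the circle is 1-Lipschitz and the torus carries the maximum metric, so torus
distances are at most Euclidean ones. -/
theorem height_sub_le {α K : ℝ≥0} (hη : HolderWith K α η) (p q : R3) :
    height η p - height η q ≤ K * dist q p ^ (α : ℝ) := by
  have hd : dist (((p 0 : UnitAddCircle), (p 1 : UnitAddCircle)) : Torus2)
      ((q 0 : UnitAddCircle), (q 1 : UnitAddCircle)) ≤ dist q p := by
    rw [Prod.dist_eq]
    exact max_le ((dist_unitAddCircle_coe_le _ _).trans (abs_sub_apply_le_dist p q 0))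
      ((dist_unitAddCircle_coe_le _ _).trans (abs_sub_apply_le_dist p q 1))
  refine (le_abs_self _).trans ((hη.dist_le _ _).trans ?_)
  gcongr

/-- Near a point of the subgraph, the complement is only reached by crossing one of the faces. -/
theorem exists_face_le {α K : ℝ≥0} (hα1 : α ≤ 1) (hη : HolderWith K α η) {p q : R3}
    (hp : p ∈ subgraph η) (hq : q ∉ subgraph η) (hpq : dist q p ≤ 1) :
    ∃ j, |p (faceDir j) - faceLevel η j p| ≤ (K + 1) * dist q p ^ (α : ℝ) := by
  obtain ⟨⟨hp00, hp01⟩, ⟨hp10, hp11⟩, hp20, hp21⟩ := hp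
  -- Within unit distance, displacements are dominated by their `α`-th powers, so flat and Hölder
  -- faces share one bound. In `K + 1`, `K` accounts for the variation of `η` and 1 for the vertical
  -- displacement.
  have hρ : dist q p ≤ dist q p ^ (α : ℝ) :=
    Real.self_le_rpow_of_le_one dist_nonneg hpq (by exact_mod_cast hα1)
  have hKρ : 0 ≤ K * dist q p ^ (α : ℝ) := by positivity
  have hc := fun i => abs_le.1 (abs_sub_apply_le_dist p q i)
  by_cases h0 : q 0 < 0
  · refine ⟨0, ?_⟩
    change |p 0 - 0| ≤ _
    rw [abs_of_nonneg (by linarith)]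
    linarith [(hc 0).2]
  by_cases h1 : 1 ≤ q 0
  · refine ⟨1, ?_⟩
    change |p 0 - 1| ≤ _
    rw [abs_of_nonpos (by linarith)]
    linarith [(hc 0).1]
  by_cases h2 : q 1 < 0
  · refine ⟨2, ?_⟩
    change |p 1 - 0| ≤ _
    rw [abs_of_nonneg (by linarith)]
    linarith [(hc 1).2]
  by_cases h3 : 1 ≤ q 1
  · refine ⟨3, ?_⟩
    change |p 1 - 1| ≤ _
    rw [abs_of_nonpos (by linarith)]
    linarith [(hc 1).1]
  by_cases h4 : q 2 ≤ 0
  · refine ⟨4, ?_⟩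
    change |p 2 - 0| ≤ _
    rw [abs_of_nonneg (by linarith)]
    linarith [(hc 2).2]
  have h5 : height η q ≤ q 2 := by
    by_contra h5
    exact hq ⟨⟨not_lt.1 h0, not_le.1 h1⟩, ⟨not_lt.1 h2, not_le.1 h3⟩, not_le.1 h4, not_le.1 h5⟩
  refine ⟨5, ?_⟩
  change |p 2 - height η p| ≤ _
  have hp21' : p 2 < height η p := hp21
  rw [abs_of_nonpos (by linarith)]
  linarith [(hc 2).1, height_sub_le hη p q]

/-- The radius of a ball around a point at distance `x` from a Hölder face which does not cross
this face. -/
noncomputable def faceRadius (α K : ℝ≥0) (x : ℝ) : ℝ≥0∞ := (‖x‖ₑ / (K + 1)) ^ ((α : ℝ)⁻¹)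

theorem faceRadius_le {α K : ℝ≥0} (hα : 0 < α) {x ρ : ℝ} (hρ : 0 ≤ ρ)
    (h : |x| ≤ (K + 1) * ρ ^ (α : ℝ)) : faceRadius α K x ≤ ENNReal.ofReal ρ := by
  have hα' : (0 : ℝ) < α := hα
  rw [faceRadius, ENNReal.rpow_inv_le_iff hα']
  refine ENNReal.div_le_of_le_mul ?_
  have hK : (K : ℝ≥0∞) + 1 = ENNReal.ofReal (K + 1) := by
    rw [ENNReal.ofReal_add K.coe_nonneg zero_le_one, ENNReal.ofReal_coe_nnreal, ENNReal.ofReal_one]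
  rw [ENNReal.ofReal_rpow_of_nonneg hρ hα'.le, hK, ← ENNReal.ofReal_mul (by positivity),
    Real.enorm_eq_ofReal_abs, mul_comm]
  exact ENNReal.ofReal_le_ofReal h

/-- The exponents `1/α` and `-2sα` multiply to `-2s`: the loss of order from `s` to `sα` exactly
offsets the Hölder geometry. -/
theorem faceRadius_rpow_neg {α K : ℝ≥0} (hα : 0 < α) (s x : ℝ) :
    faceRadius α K x ^ (-(2 * (s * α))) = ((K : ℝ≥0∞) + 1) ^ (2 * s) * ‖x‖ₑ ^ (-(2 * s)) := by
  have hα' : (α : ℝ) ≠ 0 := by exact_mod_cast hα.ne'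
  rw [faceRadius, ← ENNReal.rpow_mul, show (α : ℝ)⁻¹ * -(2 * (s * α)) = -(2 * s) by field_simp,
    div_eq_mul_inv, ENNReal.mul_rpow_of_ne_top enorm_ne_top (by simp), ENNReal.inv_rpow,
    ENNReal.rpow_neg ((K : ℝ≥0∞) + 1), inv_inv, mul_comm]

/-- The interaction of a point of the subgraph with the complement is controlled by the weights
which appear in the Hardy inequalities for the six faces. -/
theorem exists_lintegral_compl_subgraph_le {α : ℝ≥0} (hα : 0 < α) (hα1 : α ≤ 1) (K : ℝ≥0) {s : ℝ}
    (hs : 0 < s) :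
    ∃ C : ℝ≥0, ∀ {η : Torus2 → ℝ}, HolderWith K α η → ∀ p ∈ subgraph η,
      ∫⁻ q in (subgraph η)ᶜ, edist p q ^ (-(3 + 2 * (s * α))) ≤
        C * (1 + ∑ j, ‖p (faceDir j) - faceLevel η j p‖ₑ ^ (-(2 * s))) := by
  have hα' : (0 : ℝ) < α := hα
  obtain ⟨C, hC⟩ := exists_lintegral_le_enorm_le (volume : Measure R3) (b := 2 * (s * α))
    (by positivity)
  rw [finrank_euclideanSpace_fin, Nat.cast_ofNat] at hC
  have hCe : ∀ (p : R3) (R : ℝ≥0∞), ∫⁻ q in {q : R3 | R ≤ edist p q},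
      edist p q ^ (-(3 + 2 * (s * α))) ≤ C * R ^ (-(2 * (s * α))) := by
    intro p R
    have hms : MeasurableSet {q : R3 | R ≤ edist p q} :=
      measurableSet_le measurable_const (measurable_const.edist measurable_id)
    refine le_trans (le_of_eq ?_) (hC R)
    rw [← lintegral_indicator (measurableSet_le measurable_const measurable_enorm),
      ← lintegral_indicator hms, 
      ← lintegral_sub_right_eq_self
        (indicator {x : R3 | R ≤ ‖x‖ₑ} fun x => ‖x‖ₑ ^ (-(3 + 2 * (s * (α : ℝ))))) p]
    refine lintegral_congr fun q => ?_
    simp only [indicator, mem_ofPred_eq, edist_comm p, edist_eq_enorm_sub]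
  refine ⟨C * (K + 1) ^ (2 * s), fun {η} hη p hp => ?_⟩
  have hcover : (subgraph η)ᶜ ⊆ {q : R3 | 1 ≤ edist p q} ∪
      ⋃ j, {q : R3 | faceRadius α K (p (faceDir j) - faceLevel η j p) ≤ edist p q} := by
    intro q hq
    by_cases h1 : dist q p ≤ 1
    · obtain ⟨j, hj⟩ := exists_face_le hα1 hη hp hq h1
      refine Or.inr (mem_iUnion.2 ⟨j, ?_⟩)
      rw [mem_ofPred_eq, edist_comm, edist_dist]
      exact faceRadius_le hα dist_nonneg hj
    · refine Or.inl ?_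
      rw [mem_ofPred_eq, edist_comm, edist_dist, ENNReal.one_le_ofReal]
      exact (not_le.1 h1).le
  have hK : (1 : ℝ≥0∞) ≤ ((K : ℝ≥0∞) + 1) ^ (2 * s) :=
    ENNReal.one_le_rpow le_add_self (by positivity)
  calc ∫⁻ q in (subgraph η)ᶜ, edist p q ^ (-(3 + 2 * (s * α)))
      ≤ (∫⁻ q in {q : R3 | 1 ≤ edist p q}, edist p q ^ (-(3 + 2 * (s * α)))) +
          ∑ j, ∫⁻ q in {q : R3 | faceRadius α K (p (faceDir j) - faceLevel η j p) ≤ edist p q},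
            edist p q ^ (-(3 + 2 * (s * α))) := by
        refine (lintegral_mono_set hcover).trans ((lintegral_union_le _ _ _).trans ?_)
        gcongr
        refine (lintegral_iUnion_le _ _).trans (tsum_fintype _).le
    _ ≤ C * 1 ^ (-(2 * (s * α))) +
          ∑ j, C * faceRadius α K (p (faceDir j) - faceLevel η j p) ^ (-(2 * (s * α))) := by
        gcongr
        · exact hCe p 1
        · exact hCe p _
    _ ≤ C * (((K : ℝ≥0∞) + 1) ^ (2 * s) * 1) +
          ∑ j, C * (((K : ℝ≥0∞) + 1) ^ (2 * s) * ‖p (faceDir j) - faceLevel η j p‖ₑ ^ (-(2 * s))) := by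
        simp only [faceRadius_rpow_neg hα, ENNReal.one_rpow, mul_one]
        gcongr
        exact le_mul_of_one_le_right' hK
    _ = _ := by
        rw [← Finset.mul_sum, ← Finset.mul_sum, ← mul_add, ← mul_add, ← mul_assoc]
        congr 1
        rw [ENNReal.coe_mul, ENNReal.coe_rpow_of_nonneg _ (by positivity)]
        push_cast
        rfl

end Geometry

/-! ### The cost of cutting off at the boundary of a set. -/

section Indicator

variable {F : Type*} [NormedAddCommGroup F] {U : R3 → F}

/-- If both points lie on the same side, nothing new appears; otherwise the difference is the value
at the point inside `O`, recorded by one of the mixed terms. -/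
theorem enorm_indicator_sub_sq_mul_le (O : Set R3) (U : R3 → F) (k : R3 → R3 → ℝ≥0∞)
    (hk : ∀ x y, k x y = k y x) (x y : R3) :
    ‖O.indicator U x - O.indicator U y‖ₑ ^ 2 * k x y ≤ ‖U x - U y‖ₑ ^ 2 * k x y +
      (O ×ˢ Oᶜ).indicator (fun q => ‖U q.1‖ₑ ^ 2 * k q.1 q.2) (x, y) +
      (O ×ˢ Oᶜ).indicator (fun q => ‖U q.1‖ₑ ^ 2 * k q.1 q.2) (y, x) := by
  by_cases hx : x ∈ O <;> by_cases hy : y ∈ O <;> simp [hx, hy, hk y x]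

/-- The two mixed terms have equal integrals after exchanging `x` and `y`, hence the factor 2. -/
theorem gagliardoSq_indicator_le (hU : StronglyMeasurable U) {O : Set R3} (hO : MeasurableSet O)
    (t : ℝ) :
    gagliardoSq t (O.indicator U) ≤ gagliardoSq t U +
      2 * ∫⁻ x in O, ‖U x‖ₑ ^ 2 * ∫⁻ y in Oᶜ, edist x y ^ (-(3 + 2 * t)) := by
  rcases eq_or_ne t 0 with rfl | ht
  · simp [gagliardoSq]
  have hk : Measurable fun q : R3 × R3 => edist q.1 q.2 ^ (-(3 + 2 * t)) :=
    (measurable_fst.edist measurable_snd).pow_const _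
  have hU1 : Measurable fun q : R3 × R3 => ‖U q.1‖ₑ ^ 2 :=
    (hU.enorm.comp measurable_fst).pow_const 2
  obtain ⟨B, hB⟩ : ∃ B : R3 × R3 → ℝ≥0∞, B = (O ×ˢ Oᶜ).indicator
    (fun q => ‖U q.1‖ₑ ^ 2 * edist q.1 q.2 ^ (-(3 + 2 * t))) := ⟨_, rfl⟩
  have hBm : Measurable B := hB ▸ (hU1.mul hk).indicator (hO.prod hO.compl)
  have hBsw : Measurable fun q : R3 × R3 => B (q.2, q.1) := hBm.comp measurable_swap
  have hinner : ∀ x, ∫⁻ y, B (x, y) =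
      O.indicator (fun x => ‖U x‖ₑ ^ 2 * ∫⁻ y in Oᶜ, edist x y ^ (-(3 + 2 * t))) x := by
    intro x
    by_cases hx : x ∈ O
    · have hkx : Measurable fun y : R3 => edist x y ^ (-(3 + 2 * t)) :=
        (measurable_const.edist measurable_id).pow_const _
      rw [indicator_of_mem hx, ← lintegral_const_mul _ hkx, ← lintegral_indicator hO.compl]
      refine lintegral_congr fun y => ?_
      by_cases hy : y ∈ O <;> simp [hB, hx, hy]
    · simp [hB, hx]
  have hBint : ∫⁻ x, ∫⁻ y, B (x, y) =
      ∫⁻ x in O, ‖U x‖ₑ ^ 2 * ∫⁻ y in Oᶜ, edist x y ^ (-(3 + 2 * t)) := by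
    rw [lintegral_congr hinner, lintegral_indicator hO]
  have hBswap : ∫⁻ x, ∫⁻ y, B (y, x) = ∫⁻ x, ∫⁻ y, B (x, y) :=
    lintegral_lintegral_swap (f := fun x y => B (y, x)) hBsw.aemeasurable
  have h2 : 2 * ∫⁻ x in O, ‖U x‖ₑ ^ 2 * ∫⁻ y in Oᶜ, edist x y ^ (-(3 + 2 * t)) =
      (∫⁻ x, ∫⁻ y, B (x, y)) + ∫⁻ x, ∫⁻ y, B (y, x) := by
    rw [hBswap, hBint, two_mul]
  have hG := measurable_gagliardo_integrand hU t
  rw [gagliardoSq, if_neg ht, gagliardoSq, if_neg ht, h2, ← add_assoc,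
    ← lintegral_add_left hG.lintegral_prod_right', ← lintegral_add_right _ hBsw.lintegral_prod_right']
  refine lintegral_mono fun x => ?_
  have hGx : Measurable fun y => ‖U x - U y‖ₑ ^ 2 / edist x y ^ (3 + 2 * t) := by
    have hd : Measurable fun y => edist x y ^ (3 + 2 * t) :=
      (measurable_const.edist measurable_id).pow_const _
    have hn : StronglyMeasurable fun y => U x - U y := stronglyMeasurable_const.sub hU
    exact (hn.enorm.pow_const 2).div hd
  have hBx : Measurable fun y => B (y, x) := hBm.comp measurable_prodMk_right
  rw [← lintegral_add_left hGx, ← lintegral_add_right _ hBx]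
  refine lintegral_mono fun y => ?_
  have h := enorm_indicator_sub_sq_mul_le O U (fun x y => edist x y ^ (-(3 + 2 * t)))
    (fun x y => by rw [edist_comm]) x y
  rw [← hB] at h
  simpa only [ENNReal.rpow_neg, div_eq_mul_inv] using h

end Indicator

/-! ### Assembly of the estimate. -/

section Main

variable {F : Type*} [NormedAddCommGroup F]

theorem gagliardoSq_congr {u v : R3 → F} (h : u =ᵐ[volume] v) (s : ℝ) :
    gagliardoSq s u = gagliardoSq s v := by
  rw [gagliardoSq, gagliardoSq]
  congr 1
  refine lintegral_congr_ae (h.mono fun x hx => lintegral_congr_ae (h.mono fun y hy => ?_))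
  simp only [hx, hy]

theorem sobolevENorm_congr {u v : R3 → F} (h : u =ᵐ[volume] v) (s : ℝ) :
    sobolevENorm s u = sobolevENorm s v := by
  have hL2 : ∫⁻ x : R3, ‖u x‖ₑ ^ 2 = ∫⁻ x : R3, ‖v x‖ₑ ^ 2 :=
    lintegral_congr_ae (h.mono fun x hx => by simp only [hx])
  rw [sobolevENorm, sobolevENorm, gagliardoSq_congr h, hL2]

/-- Multiplication by the indicator function of a Hölder subgraph costs a factor `α` in the
order of the seminorm. -/
theorem exists_gagliardoSq_indicator_subgraph_le {α : ℝ≥0} (hα : 0 < α) (hα1 : α ≤ 1) (K : ℝ≥0)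
    {s : ℝ} (hs : 0 ≤ s) (hs' : s < 1 / 2) :
    ∃ C : ℝ≥0, ∀ {η : Torus2 → ℝ}, HolderWith K α η →
      ∀ {F : Type*} [NormedAddCommGroup F] {U : R3 → F}, StronglyMeasurable U →
        gagliardoSq (s * α) ((subgraph η).indicator U) ≤
          C * ((∫⁻ p : R3, ‖U p‖ₑ ^ 2) + gagliardoSq s U) := by
  rcases hs.eq_or_lt with rfl | hs
  -- For `s = 0` the target order is also 0, where the seminorm vanishes by convention.
  · exact ⟨0, fun _ _ _ _ _ => by simp [gagliardoSq]⟩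
  have hα' : (0 : ℝ) < α := hα
  have hα1' : (α : ℝ) ≤ 1 := hα1
  obtain ⟨C₁, hC₁⟩ := exists_gagliardoSq_le_of_le (t := s * α) (s := s) (by positivity)
    (mul_le_of_le_one_right hs.le hα1')
  obtain ⟨C₂, hC₂⟩ := exists_lintegral_compl_subgraph_le hα hα1 K hs
  obtain ⟨C₃, hC₃⟩ := exists_hardy_graph hs hs'
  -- `1 + C₁` pays for lowering the order of `U` from `s` to `sα`; the rest pays for the boundary
  -- interaction, with one Hardy inequality per face.
  refine ⟨1 + C₁ + 2 * C₂ * (1 + 6 * C₃), fun {η} hη F _ U hU => ?_⟩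
  have hηc : Continuous η := hη.continuous hα
  have hO := measurableSet_subgraph hηc
  have hm2 : Measurable fun p : R3 => ‖U p‖ₑ ^ 2 := hU.enorm.pow_const 2
  set S := (∫⁻ p : R3, ‖U p‖ₑ ^ 2) + gagliardoSq s U with hS
  have hwm : ∀ j, Measurable fun p : R3 =>
      ‖p (faceDir j) - faceLevel η j p‖ₑ ^ (-(2 * s)) * ‖U p‖ₑ ^ 2 := by
    intro j
    have hc : Measurable fun p : R3 => p (faceDir j) := by fun_prop
    exact ((hc.sub (measurable_faceLevel hηc j)).enorm.pow_const _).mul hm2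
  have hweight : ∫⁻ x in subgraph η, ‖U x‖ₑ ^ 2 *
      ∫⁻ y in (subgraph η)ᶜ, edist x y ^ (-(3 + 2 * (s * α))) ≤ C₂ * ((1 + 6 * C₃) * S) := by
    calc ∫⁻ x in subgraph η, ‖U x‖ₑ ^ 2 *
          ∫⁻ y in (subgraph η)ᶜ, edist x y ^ (-(3 + 2 * (s * α)))
        ≤ ∫⁻ x in subgraph η, C₂ * (‖U x‖ₑ ^ 2 +
            ∑ j, ‖x (faceDir j) - faceLevel η j x‖ₑ ^ (-(2 * s)) * ‖U x‖ₑ ^ 2) := by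
          refine setLIntegral_mono' hO fun x hx => ?_
          refine (mul_le_mul' le_rfl (hC₂ hη x hx)).trans (le_of_eq ?_)
          rw [← Finset.sum_mul]
          ring
      _ ≤ ∫⁻ x, C₂ * (‖U x‖ₑ ^ 2 +
            ∑ j, ‖x (faceDir j) - faceLevel η j x‖ₑ ^ (-(2 * s)) * ‖U x‖ₑ ^ 2) :=
          setLIntegral_le_lintegral _ _
      _ = C₂ * ((∫⁻ x, ‖U x‖ₑ ^ 2) +
            ∑ j, ∫⁻ x, ‖x (faceDir j) - faceLevel η j x‖ₑ ^ (-(2 * s)) * ‖U x‖ₑ ^ 2) := by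
          rw [lintegral_const_mul' _ _ ENNReal.coe_ne_top, lintegral_add_left hm2,
            lintegral_finsetSum _ fun j _ => hwm j]
      _ ≤ C₂ * (S + ∑ _j : Fin 6, C₃ * S) := by
          gcongr with j
          · exact le_self_add
          · exact hC₃ hU (faceDir j) (measurable_faceLevel hηc j) (faceLevel_add_smul j)
      _ = C₂ * ((1 + 6 * C₃) * S) := by
          rw [Finset.sum_const, Finset.card_univ, Fintype.card_fin, nsmul_eq_mul]
          push_cast
          ring
  calc gagliardoSq (s * α) ((subgraph η).indicator U)
      ≤ gagliardoSq (s * α) U + 2 * ∫⁻ x in subgraph η, ‖U x‖ₑ ^ 2 *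
          ∫⁻ y in (subgraph η)ᶜ, edist x y ^ (-(3 + 2 * (s * α))) :=
        gagliardoSq_indicator_le hU hO _
    _ ≤ (gagliardoSq s U + C₁ * ∫⁻ p : R3, ‖U p‖ₑ ^ 2) + 2 * (C₂ * ((1 + 6 * C₃) * S)) := by
        gcongr
        exact hC₁ hU
    _ ≤ (S + C₁ * S) + 2 * (C₂ * ((1 + 6 * C₃) * S)) := by
        gcongr
        · exact le_add_self
        · exact le_self_add
    _ = _ := by push_cast; ring

/-- Zero extension of restrictions to a Hölder subgraph, for globally defined functions. -/
theorem exists_sobolevENorm_indicator_subgraph_le {α : ℝ≥0} (hα : 0 < α) (hα1 : α ≤ 1) (K : ℝ≥0)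
    {s : ℝ} (hs : 0 ≤ s) (hs' : s < 1 / 2) :
    ∃ C : ℝ≥0, ∀ {η : Torus2 → ℝ}, HolderWith K α η →
      ∀ {F : Type*} [NormedAddCommGroup F] {U : R3 → F}, AEStronglyMeasurable U volume →
        sobolevENorm (s * α) ((subgraph η).indicator U) ≤ C * sobolevENorm s U := by
  obtain ⟨C, hC⟩ := exists_gagliardoSq_indicator_subgraph_le hα hα1 K hs hs'
  -- The 1 covers the `L²` part, and the square root passes from squared norms to norms.
  refine ⟨(1 + C) ^ (1 / 2 : ℝ), fun {η} hη F _ U hU => ?_⟩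
  have hae : (subgraph η).indicator U =ᵐ[volume] (subgraph η).indicator (hU.mk U) :=
    hU.ae_eq_mk.mono fun x hx => by simp only [indicator, hx]
  rw [sobolevENorm_congr hae, sobolevENorm_congr hU.ae_eq_mk]
  rw [sobolevENorm, sobolevENorm, ENNReal.coe_rpow_of_nonneg _ (by norm_num),
    ← ENNReal.mul_rpow_of_nonneg _ _ (by norm_num)]
  gcongr
  push_cast
  rw [add_mul, one_mul]
  refine add_le_add (le_trans (lintegral_mono fun p => ?_) le_self_add)
    (hC hη hU.stronglyMeasurable_mk)
  gcongr
  exact enorm_indicator_le_enorm_self _ _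

end Main

end ZeroExtension

theorem theoremB1 (α : ℝ≥0) (hα : 0 < α) (hα1 : α ≤ 1) (K : ℝ≥0) (L : ℝ)
    (s : ℝ) (hs : 0 ≤ s) (hsα : s < (α : ℝ) / 2) :
    ∃ C : ℝ≥0, ∀ η : ZeroExtension.Torus2 → ℝ,
      HolderWith K α η → (∀ p, |η p| ≤ L) →
        ∀ (d : ℕ) (u : ZeroExtension.R3 → EuclideanSpace ℝ (Fin d)),
          ZeroExtension.MemSobolevOn s (ZeroExtension.subgraph η) u →
            ZeroExtension.MemSobolev (s * α) ((ZeroExtension.subgraph η).indicator u) ∧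
            ZeroExtension.sobolevENorm (s * α) ((ZeroExtension.subgraph η).indicator u) ≤
              C * ZeroExtension.sobolevENormOn s (ZeroExtension.subgraph η) u := by
  have hα1' : (α : ℝ) ≤ 1 := hα1
  obtain ⟨C, hC⟩ := ZeroExtension.exists_sobolevENorm_indicator_subgraph_le hα hα1 K hs
    (by linarith)
  -- A nonzero constant can be moved inside the infimum over extensions.
  refine ⟨C + 1, fun η hη _ d u hu => ?_⟩
  have hO := ZeroExtension.measurableSet_subgraph (hη.continuous hα)
  have hext : ∀ U : ZeroExtension.R3 → EuclideanSpace ℝ (Fin d), ZeroExtension.MemSobolev s U →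
      U =ᵐ[volume.restrict (ZeroExtension.subgraph η)] u →
      (ZeroExtension.subgraph η).indicator U =ᵐ[volume] (ZeroExtension.subgraph η).indicator u ∧
      ZeroExtension.sobolevENorm (s * α) ((ZeroExtension.subgraph η).indicator u) ≤
        C * ZeroExtension.sobolevENorm s U := by
    intro U hU hUu
    have hae := (ae_eq_restrict_iff_indicator_ae_eq hO).1 hUu
    exact ⟨hae, ZeroExtension.sobolevENorm_congr hae (s * α) ▸ hC hη hU.1⟩
  refine ⟨?_, ?_⟩
  · obtain ⟨U, hU, hUu⟩ := hu
    obtain ⟨hae, hle⟩ := hext U hU hUu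
    exact ⟨(hU.1.indicator hO).congr hae,
      hle.trans_lt (ENNReal.mul_lt_top ENNReal.coe_lt_top hU.2)⟩
  · have h0 : ((C + 1 : ℝ≥0) : ℝ≥0∞) ≠ 0 := by simp
    simp only [ZeroExtension.sobolevENormOn, ENNReal.mul_iInf_of_ne h0 ENNReal.coe_ne_top]
    refine le_iInf fun U => le_iInf fun hU => le_iInf fun hUu => ?_
    exact (hext U hU hUu).2.trans (mul_le_mul' (by exact_mod_cast le_self_add) le_rfl)
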